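/- Consider the problem $1\,||\,\sum w_jC_j$: jobs $1,\dots,n$ with processing times $p_j>0$ and weights $w_j>0$ have to be completed on a single machine so as to minimize $\sum_j w_jC_j$, where $C_j$ is the completion time of job $j$. Let $\mathrm{OPT}(\vec p,\vec w)$ be the minimum of $\sum_j w_jC_j$ over all orders in which the jobs can be processed without interruption. A non-clairvoyant kill-and-restart strategy knows the weights but not the processing times. It probes jobs: probing an unfinished job $j$ for time $\tau$ completes the job after $p_j$ time units if $p_j\le\tau$; otherwise the job is aborted after $\tau$ time units and must later be restarted from the beginning. For $b>1$, a permutation $\sigma$ of the jobs and $\xi\in[0,1]$, the $b$-scaling strategy $\mathrm{ALG}_b^{\sigma,\xi}$ works in rounds $q\in\mathbb Z$, in increasing order and without idle time, starting with the infinitely many rounds $q\to-\infty$ at time $0$. In round $q$ every job $j$ that is still unfinished is probed once, for time $w_jb^{q+\xi}$, in the order of increasing $\sigma(j)$. (Thus, as long as no job is finished, round $q$ starts at time $\frac{b^{q+\xi}}{b-1}\sum_j w_j$.) The randomized strategy is $\mathfrak R_b=\mathrm{ALG}_b^{\Sigma,\Xi}$, where $\Sigma$ is a uniformly random permutation and $\Xi$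 is, independently, uniformly distributed on $[0,1]$. A randomized strategy is $c$-competitive if, for every $n$ and every instance $(\vec p,\vec w)$ with $n$ jobs, its cost $\sum_jw_jC_j$ is a random variable whose expectation is at most $c\cdot\mathrm{OPT}(\vec p,\vec w)$. **Theorem.** For every $b>1$, the strategy $\mathfrak R_b$ is $\dfrac{\sqrt b+2b-1}{\sqrt b\,\log b}$-competitive for $1\,||\,\sum w_jC_j$, where $\log$ is the natural logarithm. Over $b>1$, this ratio has a unique minimizer $b_0$; it satisfies $|b_0-8.16|<0.005$, and the ratio at $b_0$ is less than $3.032$. -/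

import Mathlib

noncomputable section

namespace KillRestart

/-- A state `(μ, U, θ)`: learned lower bounds on the processing times, the set of unfinished
jobs, and the current time. -/
@[ext]
structure State (n : ℕ) where
  lower : Fin n → ℝ
  unfinished : Finset (Fin n)
  time : ℝ

/-- A planned probing `(t, j, τ)`: job `j` is probed from time `t` on, for at most `τ` time
units. -/
@[ext]
structure Probing (n : ℕ) where
  start : ℝ
  job : Fin n
  dur : ℝ

/-- The open time interval reserved for a probing. -/
def Probing.interval {n : ℕ} (x : Probing n) : Set ℝ := Set.Ioo x.start (x.start + x.dur)

/-- The kill-and-restart actions available in state `s`: families of probings of unfinished jobs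
with pairwise disjoint intervals that lie after the current time. -/
def actions {n : ℕ} (s : State n) : Set (Set (Probing n)) :=
  {a | (∀ x ∈ a, x.job ∈ s.unfinished ∧ x.interval ⊆ Set.Ioi s.time) ∧
    a.PairwiseDisjoint Probing.interval}

/-- A (deterministic) kill-and-restart strategy for `n` jobs. It sees only the state, hence
never the processing time of an unfinished job. -/
structure Strategy (n : ℕ) where
  action : State n → Set (Probing n)
  action_mem : ∀ s, action s ∈ actions s

/-- The probing `x` of the action `a` is the first one that leads to the completion of a job, when
the processing times are `p`. -/
def IsFirstCompletion {n : ℕ} (p : Fin n → ℝ) (a : Set (Probing n)) (x : Probing n) : Prop :=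
  (x ∈ a ∧ p x.job ≤ x.dur) ∧
    ∀ y ∈ a, p y.job ≤ y.dur → x.start + p x.job ≤ y.start + p y.job

open Classical in
/-- The transition function for the processing times `p`. If no probing of `a` is the first to
complete a job, the state does not change. -/
def transition {n : ℕ} (p : Fin n → ℝ) (s : State n) (a : Set (Probing n)) : State n :=
  if h : ∃ x, IsFirstCompletion p a x then
    { lower := fun j => sSup (insert (s.lower j)
        {v | ∃ y ∈ a, y.start ≤ h.choose.start ∧ y.job = j ∧ v = min y.dur (p j)})
      unfinished := s.unfinished.erase h.choose.job
      time := h.choose.start + p h.choose.job }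
  else s

/-- The initial state: nothing is known, all jobs are unfinished, the time is `0`. -/
def initialState (n : ℕ) : State n where
  lower := 0
  unfinished := Finset.univ
  time := 0

/-- The state reached after `m` actions of the strategy. -/
def stateAfter {n : ℕ} (S : Strategy n) (p : Fin n → ℝ) : ℕ → State n
  | 0 => initialState n
  | m + 1 => transition p (stateAfter S p m) (S.action (stateAfter S p m))

/-- The completion time of job `j`: the time of the first state in which `j` is finished, and `∞`
if there is no such state. -/
def completionTime {n : ℕ} (S : Strategy n) (p : Fin n → ℝ) (j : Fin n) : ENNReal :=
  ⨅ (m : ℕ) (_ : j ∉ (stateAfter S p m).unfinished), ENNReal.ofReal (stateAfter S p m).time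

/-- The cost `∑ w_j C_j` of the schedule constructed by a strategy. -/
def cost {n : ℕ} (S : Strategy n) (p w : Fin n → ℝ) : ENNReal :=
  ∑ j, ENNReal.ofReal (w j) * completionTime S p j

/-- The cost `∑ w_j C_j` of sequencing the jobs without interruption, job `j` in position
`π j`. -/
def sequenceCost {n : ℕ} (p w : Fin n → ℝ) (π : Equiv.Perm (Fin n)) : ℝ :=
  ∑ j, w j * ∑ k with π k ≤ π j, p k

/-- The optimal clairvoyant cost: the minimum of `∑ w_j C_j` over all sequences of the jobs. -/
def opt {n : ℕ} (p w : Fin n → ℝ) : ℝ :=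
  Finset.univ.inf' Finset.univ_nonempty (sequenceCost p w)

/-- A randomized kill-and-restart strategy for `n` jobs. -/
structure RandomizedStrategy (n : ℕ) where
  Ω : Type
  [measurableSpace : MeasurableSpace Ω]
  law : MeasureTheory.Measure Ω
  [isProbabilityMeasure : MeasureTheory.IsProbabilityMeasure law]
  strategy : Ω → Strategy n

/-- A randomized strategy, which knows the number of jobs and their (positive) weights, is
`c`-competitive if, on every instance, its cost is a random variable whose expectation is at most
`c` times the optimal cost. -/
def IsCompetitive
    (R : (n : ℕ) → (w : Fin n → ℝ) → (∀ j, 0 < w j) → RandomizedStrategy n) (c : ℝ) : Prop :=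
  ∀ (n : ℕ) (p w : Fin n → ℝ) (_ : ∀ j, 0 < p j) (hw : ∀ j, 0 < w j),
    letI := (R n w hw).measurableSpace
    AEMeasurable (fun ω => cost ((R n w hw).strategy ω) p w) (R n w hw).law ∧
      ∫⁻ ω, cost ((R n w hw).strategy ω) p w ∂(R n w hw).law ≤ ENNReal.ofReal (c * opt p w)

section BScaling

variable {n : ℕ}

/-- The total weight of the jobs in `J` that come before `j` in the order given by `σ`. -/
def weightBefore (σ : Equiv.Perm (Fin n)) (w : Fin n → ℝ) (J : Finset (Fin n)) (j : Fin n) : ℝ :=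
  ∑ k ∈ J with σ k < σ j, w k

/-- The action in the initial state: for every round `q ∈ ℤ`, every job `j` is probed
for `w_j b ^ (q + ξ)`, in the order given by `σ`. -/
def firstAction (b : ℝ) (σ : Equiv.Perm (Fin n)) (ξ : ℝ) (w : Fin n → ℝ) : Set (Probing n) :=
  {x | ∃ (q : ℤ) (j : Fin n), x =
    { start := b ^ ((q : ℝ) + ξ) / (b - 1) * ∑ k, w k
        + b ^ ((q : ℝ) + ξ) * weightBefore σ w Finset.univ j
      job := j
      dur := w j * b ^ ((q : ℝ) + ξ) }}

/-- The jobs in `U` that have not yet been probed in round `q`. -/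
def pending (b ξ : ℝ) (w : Fin n → ℝ) (s : State n) (q : ℤ) : Finset (Fin n) :=
  open Classical in s.unfinished.filter fun j => s.lower j = w j * b ^ ((q : ℝ) + ξ - 1)

/-- The time at which round `q` starts, when the current round is `r`. -/
def roundStart (b ξ : ℝ) (w : Fin n → ℝ) (s : State n) (r q : ℤ) : ℝ :=
  s.time + b ^ ((r : ℝ) + ξ) * ∑ k ∈ pending b ξ w s r, w k
    + (b ^ ((q : ℝ) + ξ) - b ^ ((r : ℝ) + 1 + ξ)) / (b - 1) * ∑ k ∈ s.unfinished, w k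

/-- The action in a later state, when the current round is `r`: finish round `r`, then go on with
the rounds `q > r`. -/
def laterAction (b : ℝ) (σ : Equiv.Perm (Fin n)) (ξ : ℝ) (w : Fin n → ℝ) (s : State n) (r : ℤ) :
    Set (Probing n) :=
  {x | ∃ j ∈ pending b ξ w s r, x =
    { start := s.time + b ^ ((r : ℝ) + ξ) * weightBefore σ w (pending b ξ w s r) j
      job := j
      dur := w j * b ^ ((r : ℝ) + ξ) }} ∪
  {x | ∃ q : ℤ, r < q ∧ ∃ j ∈ s.unfinished, x =
    { start := roundStart b ξ w s r q + b ^ ((q : ℝ) + ξ) * weightBefore σ w s.unfinished j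
      job := j
      dur := w j * b ^ ((q : ℝ) + ξ) }}

/-- In state `s`, every unfinished job was last probed in round `r` or in round `r - 1`. -/
def IsCurrentRound (b ξ : ℝ) (w : Fin n → ℝ) (s : State n) (r : ℤ) : Prop :=
  ∀ j ∈ s.unfinished,
    s.lower j = w j * b ^ ((r : ℝ) + ξ - 1) ∨ s.lower j = w j * b ^ ((r : ℝ) + ξ)

open Classical in
/-- The action of the `b`-scaling strategy with job order `σ` and offset `ξ`. In states that the
strategy never reaches, nothing is planned. -/
def bScalingAction (b : ℝ) (σ : Equiv.Perm (Fin n)) (ξ : ℝ) (w : Fin n → ℝ) (s : State n) :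
    Set (Probing n) :=
  if s = initialState n then firstAction b σ ξ w
  else if h : ∃ r, IsCurrentRound b ξ w s r then laterAction b σ ξ w s h.choose
  else ∅

theorem disjoint_interval {x y : Probing n} (h : x.start + x.dur ≤ y.start) :
    Disjoint x.interval y.interval := by
  rw [Set.disjoint_left]
  intro t hx hy
  simp only [Probing.interval, Set.mem_Ioo] at hx hy
  linarith

theorem weightBefore_nonneg (σ : Equiv.Perm (Fin n)) {w : Fin n → ℝ} (hw : ∀ j, 0 < w j)
    (J : Finset (Fin n)) (j : Fin n) : 0 ≤ weightBefore σ w J j :=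
  Finset.sum_nonneg fun k _ => (hw k).le

theorem weightBefore_add_le_sum (σ : Equiv.Perm (Fin n)) {w : Fin n → ℝ} (hw : ∀ j, 0 < w j)
    {J : Finset (Fin n)} {j : Fin n} (hj : j ∈ J) : weightBefore σ w J j + w j ≤ ∑ k ∈ J, w k := by
  have h : j ∉ J.filter fun k => σ k < σ j := by simp
  rw [weightBefore, add_comm, ← Finset.sum_insert h]
  refine Finset.sum_le_sum_of_subset_of_nonneg ?_ fun k _ _ => (hw k).le
  intro k hk
  rcases Finset.mem_insert.1 hk with rfl | hk
  · exact hj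
  · exact (Finset.mem_filter.1 hk).1

theorem weightBefore_add_le (σ : Equiv.Perm (Fin n)) {w : Fin n → ℝ} (hw : ∀ j, 0 < w j)
    {J : Finset (Fin n)} {j k : Fin n} (hj : j ∈ J) (hjk : σ j < σ k) :
    weightBefore σ w J j + w j ≤ weightBefore σ w J k := by
  have h : j ∉ J.filter fun k => σ k < σ j := by simp
  rw [weightBefore, weightBefore, add_comm, ← Finset.sum_insert h]
  refine Finset.sum_le_sum_of_subset_of_nonneg ?_ fun k _ _ => (hw k).le
  intro i hi
  rcases Finset.mem_insert.1 hi with rfl | hi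
  · exact Finset.mem_filter.2 ⟨hj, hjk⟩
  · exact Finset.mem_filter.2 ⟨(Finset.mem_filter.1 hi).1, (Finset.mem_filter.1 hi).2.trans hjk⟩

/-- A probing of a round that starts at time `t` and has unit `c` ends before round end. -/
theorem end_le_round_end (σ : Equiv.Perm (Fin n)) {w : Fin n → ℝ} (hw : ∀ j, 0 < w j)
    {J : Finset (Fin n)} {j : Fin n} (hj : j ∈ J) (t : ℝ) {c : ℝ} (hc : 0 ≤ c) :
    t + c * weightBefore σ w J j + w j * c ≤ t + c * ∑ k ∈ J, w k := by
  nlinarith [mul_le_mul_of_nonneg_left (weightBefore_add_le_sum σ hw hj) hc]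

/-- Two probings of the same round do not overlap. -/
theorem disjoint_of_same_round (σ : Equiv.Perm (Fin n)) {w : Fin n → ℝ} (hw : ∀ j, 0 < w j)
    {J : Finset (Fin n)} {j k : Fin n} (hj : j ∈ J) (hk : k ∈ J) (hjk : j ≠ k) (t : ℝ) {c : ℝ}
    (hc : 0 ≤ c) :
    Disjoint (Probing.interval ⟨t + c * weightBefore σ w J j, j, w j * c⟩)
      (Probing.interval ⟨t + c * weightBefore σ w J k, k, w k * c⟩) := by
  rcases lt_or_gt_of_ne (σ.injective.ne hjk) with h | h
  · apply disjoint_interval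
    have := mul_le_mul_of_nonneg_left (weightBefore_add_le σ hw hj h) hc
    dsimp only
    linarith
  · apply Disjoint.symm
    apply disjoint_interval
    have := mul_le_mul_of_nonneg_left (weightBefore_add_le σ hw hk h) hc
    dsimp only
    linarith

theorem rpow_succ_le {b : ℝ} (hb : 1 < b) (ξ : ℝ) {q r : ℤ} (h : q < r) :
    b ^ ((q : ℝ) + ξ) * b ≤ b ^ ((r : ℝ) + ξ) := by
  rw [← Real.rpow_add_one (by linarith)]
  apply Real.rpow_le_rpow_of_exponent_le hb.le
  have : ((q + 1 : ℤ) : ℝ) ≤ r := by exact_mod_cast h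
  push_cast at this
  linarith

/-- The geometric sum behind the starting times of the rounds. -/
theorem round_gap {b : ℝ} (hb : 1 < b) (ξ : ℝ) {q r : ℤ} (h : q < r) :
    b ^ ((q : ℝ) + ξ) / (b - 1) + b ^ ((q : ℝ) + ξ) ≤ b ^ ((r : ℝ) + ξ) / (b - 1) := by
  have hb' : 0 < b - 1 := by linarith
  have h1 := rpow_succ_le hb ξ h
  rw [div_add' _ _ _ hb'.ne', div_le_div_iff_of_pos_right hb']
  linarith

theorem firstAction_mem {b : ℝ} (hb : 1 < b) (σ : Equiv.Perm (Fin n)) (ξ : ℝ) {w : Fin n → ℝ}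
    (hw : ∀ j, 0 < w j) : firstAction b σ ξ w ∈ actions (initialState n) := by
  have hb' : 0 < b - 1 := by linarith
  have hc : ∀ q : ℤ, 0 < b ^ ((q : ℝ) + ξ) := fun q => Real.rpow_pos_of_pos (by linarith) _
  have hW : 0 ≤ ∑ k, w k := Finset.sum_nonneg fun k _ => (hw k).le
  refine ⟨?_, ?_⟩
  · rintro _ ⟨q, j, rfl⟩
    refine ⟨Finset.mem_univ _, fun t ht => lt_of_le_of_lt ?_ ht.1⟩
    have := weightBefore_nonneg σ hw Finset.univ j
    have := (hc q).le
    simp only [initialState]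
    positivity
  · have key : ∀ (q r : ℤ) (j k : Fin n), q < r → Disjoint
        (Probing.interval ⟨b ^ ((q : ℝ) + ξ) / (b - 1) * ∑ k, w k
          + b ^ ((q : ℝ) + ξ) * weightBefore σ w Finset.univ j, j, w j * b ^ ((q : ℝ) + ξ)⟩)
        (Probing.interval ⟨b ^ ((r : ℝ) + ξ) / (b - 1) * ∑ k, w k
          + b ^ ((r : ℝ) + ξ) * weightBefore σ w Finset.univ k, k, w k * b ^ ((r : ℝ) + ξ)⟩) := by
      intro q r j k h
      apply disjoint_interval
      have h1 := end_le_round_end σ hw (Finset.mem_univ j)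
        (b ^ ((q : ℝ) + ξ) / (b - 1) * ∑ k, w k) (hc q).le
      have h2 := mul_le_mul_of_nonneg_right (round_gap hb ξ h) hW
      have h3 := mul_nonneg (hc r).le (weightBefore_nonneg σ hw Finset.univ k)
      dsimp only
      linarith
    rintro _ ⟨q, j, rfl⟩ _ ⟨r, k, rfl⟩ hne
    rcases lt_trichotomy q r with h | rfl | h
    · exact key q r j k h
    · refine disjoint_of_same_round σ hw (Finset.mem_univ j) (Finset.mem_univ k) ?_ _ (hc q).le
      rintro rfl
      exact hne rfl
    · exact (key r q k j h).symm

theorem laterAction_mem {b : ℝ} (hb : 1 < b) (σ : Equiv.Perm (Fin n)) (ξ : ℝ) {w : Fin n → ℝ}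
    (hw : ∀ j, 0 < w j) (s : State n) (r : ℤ) : laterAction b σ ξ w s r ∈ actions s := by
  have hb' : 0 < b - 1 := by linarith
  have hc : ∀ q : ℤ, 0 < b ^ ((q : ℝ) + ξ) := fun q => Real.rpow_pos_of_pos (by linarith) _
  have hW : 0 ≤ ∑ k ∈ s.unfinished, w k := Finset.sum_nonneg fun k _ => (hw k).le
  have hsub : pending b ξ w s r ⊆ s.unfinished := by
    unfold pending
    exact Finset.filter_subset _ _
  have hP : 0 ≤ ∑ k ∈ pending b ξ w s r, w k := Finset.sum_nonneg fun k _ => (hw k).le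
  have hstart : ∀ q : ℤ, r < q →
      s.time + b ^ ((r : ℝ) + ξ) * ∑ k ∈ pending b ξ w s r, w k ≤ roundStart b ξ w s r q := by
    intro q hq
    have h1 := rpow_succ_le hb ξ hq
    rw [← Real.rpow_add_one (by linarith), add_right_comm] at h1
    have h2 : 0 ≤ (b ^ ((q : ℝ) + ξ) - b ^ ((r : ℝ) + 1 + ξ)) / (b - 1) :=
      div_nonneg (by linarith) hb'.le
    have h3 := mul_nonneg h2 hW
    unfold roundStart
    linarith
  have hgap : ∀ q q' : ℤ, q < q' →
      roundStart b ξ w s r q + b ^ ((q : ℝ) + ξ) * ∑ k ∈ s.unfinished, w k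
        ≤ roundStart b ξ w s r q' := by
    intro q q' h
    have h2 := mul_le_mul_of_nonneg_right (round_gap hb ξ h) hW
    unfold roundStart
    rw [sub_div, sub_div]
    linarith
  refine ⟨?_, ?_⟩
  · rintro _ (⟨j, hj, rfl⟩ | ⟨q, hq, j, hj, rfl⟩)
    · refine ⟨hsub hj, fun t ht => lt_of_le_of_lt ?_ ht.1⟩
      have := mul_nonneg (hc r).le (weightBefore_nonneg σ hw (pending b ξ w s r) j)
      dsimp only
      linarith
    · refine ⟨hj, fun t ht => lt_of_le_of_lt ?_ ht.1⟩
      have h1 := mul_nonneg (hc q).le (weightBefore_nonneg σ hw s.unfinished j)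
      have h2 := hstart q hq
      have h3 := mul_nonneg (hc r).le hP
      dsimp only
      linarith
  · have key1 : ∀ (q : ℤ) (j k : Fin n), r < q → j ∈ pending b ξ w s r → Disjoint
        (Probing.interval ⟨s.time + b ^ ((r : ℝ) + ξ) * weightBefore σ w (pending b ξ w s r) j,
          j, w j * b ^ ((r : ℝ) + ξ)⟩)
        (Probing.interval ⟨roundStart b ξ w s r q
          + b ^ ((q : ℝ) + ξ) * weightBefore σ w s.unfinished k, k, w k * b ^ ((q : ℝ) + ξ)⟩) := by
      intro q j k hq hj
      apply disjoint_interval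
      have h1 := end_le_round_end σ hw hj s.time (hc r).le
      have h2 := hstart q hq
      have h3 := mul_nonneg (hc q).le (weightBefore_nonneg σ hw s.unfinished k)
      dsimp only
      linarith
    have key2 : ∀ (q q' : ℤ) (j k : Fin n), q < q' → j ∈ s.unfinished → Disjoint
        (Probing.interval ⟨roundStart b ξ w s r q
          + b ^ ((q : ℝ) + ξ) * weightBefore σ w s.unfinished j, j, w j * b ^ ((q : ℝ) + ξ)⟩)
        (Probing.interval ⟨roundStart b ξ w s r q'
          + b ^ ((q' : ℝ) + ξ) * weightBefore σ w s.unfinished k, k, w k * b ^ ((q' : ℝ) + ξ)⟩) := by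
      intro q q' j k hq hj
      apply disjoint_interval
      have h1 := end_le_round_end σ hw hj (roundStart b ξ w s r q) (hc q).le
      have h2 := hgap q q' hq
      have h3 := mul_nonneg (hc q').le (weightBefore_nonneg σ hw s.unfinished k)
      dsimp only
      linarith
    rintro _ (⟨j, hj, rfl⟩ | ⟨q, hq, j, hj, rfl⟩) _ (⟨k, hk, rfl⟩ | ⟨q', hq', k, hk, rfl⟩) hne
    · refine disjoint_of_same_round σ hw hj hk ?_ _ (hc r).le
      rintro rfl
      exact hne rfl
    · exact key1 q' j k hq' hj
    · exact (key1 q k j hq hk).symm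
    · rcases lt_trichotomy q q' with h | rfl | h
      · exact key2 q q' j k h hj
      · refine disjoint_of_same_round σ hw hj hk ?_ _ (hc q).le
        rintro rfl
        exact hne rfl
      · exact (key2 q' q k j h hk).symm

theorem bScalingAction_mem {b : ℝ} (hb : 1 < b) (σ : Equiv.Perm (Fin n)) (ξ : ℝ) {w : Fin n → ℝ}
    (hw : ∀ j, 0 < w j) (s : State n) : bScalingAction b σ ξ w s ∈ actions s := by
  unfold bScalingAction
  split_ifs with h1 h2
  · rw [h1]
    exact firstAction_mem hb σ ξ hw
  · exact laterAction_mem hb σ ξ hw s _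
  · simp [actions]

/-- The `b`-scaling strategy with job order `σ` and offset `ξ`. -/
def bScaling (b : ℝ) (hb : 1 < b) (σ : Equiv.Perm (Fin n)) (ξ : ℝ) (w : Fin n → ℝ)
    (hw : ∀ j, 0 < w j) : Strategy n where
  action := bScalingAction b σ ξ w
  action_mem := bScalingAction_mem hb σ ξ hw

/-- Every set of job orders is an event. -/
instance permMeasurableSpace : MeasurableSpace (Equiv.Perm (Fin n)) := ⊤

/-- The uniform distribution on the offsets in `[0, 1]`. -/
def uniformOffset : MeasureTheory.Measure ℝ :=
  MeasureTheory.volume.restrict (Set.Icc 0 1)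

instance uniformOffset_isProbabilityMeasure :
    MeasureTheory.IsProbabilityMeasure uniformOffset :=
  ⟨by simp [uniformOffset]⟩

/-- The randomized `b`-scaling strategy: the job order is a uniformly random permutation and the
offset is, independently, uniformly distributed on `[0, 1]`. -/
def randomizedBScaling (b : ℝ) (hb : 1 < b) (n : ℕ) (w : Fin n → ℝ) (hw : ∀ j, 0 < w j) :
    RandomizedStrategy n where
  Ω := Equiv.Perm (Fin n) × ℝ
  law := (PMF.uniformOfFintype (Equiv.Perm (Fin n))).toMeasure.prod uniformOffset
  strategy := fun ω => bScaling b hb ω.1 ω.2 w hw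

end BScaling

end KillRestart

end

/-! The cost splits over pairs of jobs. Job `j` waits, for every `l`, as long as the machine has
worked on `l` before `j` completes. If `l` has been probed unsuccessfully in all rounds before `r`,
this is a geometric series, `w l * b ^ (r + ξ) / (b - 1)`; if `l` is already finished, `p l` is
added. Hence the cost is `∑ j, ∑ k, w j * timeSpent j k`, and only the finishing rounds and the
order `σ` matter (`cost_bScaling`). Proving this for the formal strategy means following its states
from one completion to the next.

Put `x j = p j / w j`. Since `ξ` is uniform, the unit of the finishing round of `j` is `x j * b ^ u`
with `u` uniform on `[0, 1]`, so the expected mutual delay of two jobs is an explicit integral.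
Averaged over their two relative orders it is `w j * w k * pairKernel b (x j) (x k)`, and the
expected cost is half of `∑ j, ∑ k, w j * w k * pairKernel b (x j) (x k) + ∑ j, w j * p j`
(`lintegral_cost`). The optimum is at least the same expression with `min` in place of `pairKernel
b` (`le_sequenceCost`).

A comparison pair by pair would lose too much; the two quadratic forms are compared as a whole. The
kernel `min` is positive semidefinite, and testing it on the points `x i` and `μ ^ 2 * x i` with
opposite signs bounds the form of `min x (μ ^ 2 * y)` by `μ` times the form of `min`
(`sum_mul_min_scale_le`). As `pairKernel` is a positive mixture of kernels `min x (c * y)`,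
integrating `√c` against the mixture yields the ratio (`sum_mul_pairKernel_le`). The remaining term
`∑ j, w j * p j` is absorbed because the ratio is at least `1`.

The minimization over `b` is one-variable calculus in `s = √b`. -/

noncomputable section

namespace KillRestart

/-! ### Rounds, slots and time accounting -/

section Simulation

variable {n : ℕ} {b ξ : ℝ} {σ : Equiv.Perm (Fin n)} {p w : Fin n → ℝ} {f : Fin n → ℤ}

/-- The probing time per unit of weight in round `q`. -/
def unit (b ξ : ℝ) (q : ℤ) : ℝ := b ^ ((q : ℝ) + ξ)

theorem unit_pos (hb : 1 < b) (q : ℤ) : 0 < unit b ξ q :=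
  Real.rpow_pos_of_pos (by linarith) _

theorem unit_add_one (hb : 1 < b) (q : ℤ) : unit b ξ (q + 1) = b * unit b ξ q := by
  unfold unit
  rw [mul_comm, ← Real.rpow_add_one (by linarith)]
  push_cast
  ring_nf

theorem unit_mono (hb : 1 < b) {q r : ℤ} (h : q ≤ r) : unit b ξ q ≤ unit b ξ r :=
  Real.rpow_le_rpow_of_exponent_le hb.le (by gcongr)

theorem unit_strictMono (hb : 1 < b) : StrictMono (unit b ξ) := fun _ _ h =>
  Real.rpow_lt_rpow_of_exponent_lt hb (by gcongr)

theorem unit_sub_one (q : ℤ) : b ^ ((q : ℝ) + ξ - 1) = unit b ξ (q - 1) := by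
  unfold unit
  push_cast
  ring_nf

theorem unit_add_one_div (hb : 1 < b) (q : ℤ) :
    unit b ξ (q + 1) / (b - 1) = unit b ξ q / (b - 1) + unit b ξ q := by
  have : b - 1 ≠ 0 := by linarith
  rw [unit_add_one hb]
  field_simp
  ring

/-- The position of the probing of job `j` in round `q` in the sequence of all probings. -/
def slot (σ : Equiv.Perm (Fin n)) (q : ℤ) (j : Fin n) : ℤ ×ₗ Fin n := toLex (q, σ j)

theorem slot_lt {q r : ℤ} {j k : Fin n} : slot σ q j < slot σ r k ↔ q < r ∨ q = r ∧ σ j < σ k :=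
  Prod.Lex.toLex_lt_toLex

theorem slot_le {q r : ℤ} {j k : Fin n} : slot σ q j ≤ slot σ r k ↔ q < r ∨ q = r ∧ σ j ≤ σ k :=
  Prod.Lex.toLex_le_toLex

theorem slot_eq {q r : ℤ} {j k : Fin n} (h : slot σ q j = slot σ r k) : q = r ∧ j = k := by
  have h' : (q, σ j) = (r, σ k) := toLex.injective h
  simpa using h'

/-- The first round in which job `l` has not been probed when the probing of job `j` in round `q`
starts. -/
def nextRound (σ : Equiv.Perm (Fin n)) (q : ℤ) (j l : Fin n) : ℤ := if σ l < σ j then q + 1 else q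

theorem nextRound_self (q : ℤ) (j : Fin n) : nextRound σ q j j = q := by simp [nextRound]

theorem nextRound_mono {q r : ℤ} {j k : Fin n} (h : slot σ q j < slot σ r k) (l : Fin n) :
    nextRound σ q j l ≤ nextRound σ r k l := by
  unfold nextRound
  rcases slot_lt.1 h with h | ⟨rfl, hjk⟩
  · split_ifs <;> omega
  · split_ifs with h1 h2
    · rfl
    · exact absurd (h1.trans hjk) h2
    · omega
    · rfl

theorem lt_nextRound_iff {q r : ℤ} {j l : Fin n} (hjl : l ≠ j) :
    r < nextRound σ q j l ↔ slot σ r l < slot σ q j := by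
  have := σ.injective.ne hjl
  rw [slot_lt]
  unfold nextRound
  split_ifs with h
  · simp only [h, and_true]; omega
  · simp only [h, and_false, or_false]

/-- The total time spent on `l` when it is finished in round `f l`. -/
def timeFinished (b ξ : ℝ) (p w : Fin n → ℝ) (f : Fin n → ℤ) (l : Fin n) : ℝ :=
  p l + w l * (unit b ξ (f l) / (b - 1))

/-- The starting time of the probing of job `j` in round `q`, if the jobs in `U` and only these are
unfinished at that time. -/
def plannedStart (b ξ : ℝ) (σ : Equiv.Perm (Fin n)) (p w : Fin n → ℝ) (f : Fin n → ℤ)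
    (U : Finset (Fin n)) (q : ℤ) (j : Fin n) : ℝ :=
  ∑ l, if l ∈ U then w l * (unit b ξ (nextRound σ q j l) / (b - 1)) else timeFinished b ξ p w f l

/-- The time spent on job `l` before the completion of job `j`. -/
def timeSpent (b ξ : ℝ) (σ : Equiv.Perm (Fin n)) (p w : Fin n → ℝ) (f : Fin n → ℤ)
    (j l : Fin n) : ℝ :=
  if slot σ (f l) l ≤ slot σ (f j) j then timeFinished b ξ p w f l
  else w l * (unit b ξ (nextRound σ (f j) j l) / (b - 1))

/-- The completion time of job `j`, if job `l` is finished in round `f l`. -/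
def finishTime (b ξ : ℝ) (σ : Equiv.Perm (Fin n)) (p w : Fin n → ℝ) (f : Fin n → ℤ)
    (j : Fin n) : ℝ :=
  ∑ l, timeSpent b ξ σ p w f j l

/-- The probings of the jobs in `U` in those rounds that satisfy `R`. -/
def plan (b ξ : ℝ) (σ : Equiv.Perm (Fin n)) (p w : Fin n → ℝ) (f : Fin n → ℤ)
    (U : Finset (Fin n)) (R : Fin n → ℤ → Prop) : Set (Probing n) :=
  {z | ∃ (q : ℤ) (k : Fin n), k ∈ U ∧ R k q ∧ z =
    { start := plannedStart b ξ σ p w f U q k, job := k, dur := w k * unit b ξ q }}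

/-- Compared job by job, the time invested never decreases from one slot to a later one, and for `j`
the geometric sum gains at least the summand of round `q`. -/
theorem plannedStart_add_le (hb : 1 < b) (hw : ∀ j, 0 < w j) {U : Finset (Fin n)} {q r : ℤ}
    {j k : Fin n} (hj : j ∈ U) (h : slot σ q j < slot σ r k) :
    plannedStart b ξ σ p w f U q j + w j * unit b ξ q ≤ plannedStart b ξ σ p w f U r k := by
  have hb' : 0 < b - 1 := by linarith
  have hsum : w j * unit b ξ q = ∑ l, if l = j then w j * unit b ξ q else 0 := by simp
  rw [hsum, plannedStart, plannedStart, ← Finset.sum_add_distrib]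
  refine Finset.sum_le_sum fun l _ => ?_
  by_cases hl : l = j
  · subst hl
    simp only [hj, if_true, nextRound_self]
    rw [← mul_add, ← unit_add_one_div hb]
    refine mul_le_mul_of_nonneg_left ?_ (hw l).le
    refine div_le_div_of_nonneg_right (unit_mono hb ?_) hb'.le
    unfold nextRound
    rcases slot_lt.1 h with h | ⟨rfl, hjk⟩
    · split_ifs <;> omega
    · simp [hjk]
  · simp only [hl, if_false, add_zero]
    split_ifs
    · refine mul_le_mul_of_nonneg_left ?_ (hw l).le
      exact div_le_div_of_nonneg_right (unit_mono hb (nextRound_mono h l)) hb'.le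
    · rfl

/-- Holds summand by summand: the time spent on each fixed job grows along the slots. -/
theorem finishTime_mono (hb : 1 < b) (hp : ∀ j, 0 < p j) (hw : ∀ j, 0 < w j) {j k : Fin n}
    (h : slot σ (f j) j < slot σ (f k) k) :
    finishTime b ξ σ p w f j ≤ finishTime b ξ σ p w f k := by
  have hb' : 0 < b - 1 := by linarith
  refine Finset.sum_le_sum fun l _ => ?_
  unfold timeSpent
  split_ifs with h1 h2 h2
  · rfl
  · exact absurd (h1.trans h.le) h2
  · unfold timeFinished
    have : unit b ξ (nextRound σ (f j) j l) / (b - 1) ≤ unit b ξ (f l) / (b - 1) := by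
      refine div_le_div_of_nonneg_right (unit_mono hb ?_) hb'.le
      rcases slot_lt.1 (not_le.1 h1) with h3 | ⟨h3, h4⟩
      · unfold nextRound
        split_ifs <;> omega
      · simp [nextRound, h3, h4.le.not_gt]
    have := mul_le_mul_of_nonneg_left this (hw l).le
    have := hp l
    linarith
  · refine mul_le_mul_of_nonneg_left ?_ (hw l).le
    exact div_le_div_of_nonneg_right (unit_mono hb (nextRound_mono h l)) hb'.le

/-- If job `y` is the first job of `U` to be finished, its completion time is the starting time
of its last probing plus its processing time. -/
theorem plannedStart_add_eq_finishTime {U : Finset (Fin n)} {y : Fin n} (hy : y ∈ U)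
    (hU : ∀ k, k ∈ U ↔ slot σ (f y) y ≤ slot σ (f k) k) :
    plannedStart b ξ σ p w f U (f y) y + p y = finishTime b ξ σ p w f y := by
  have hsum : p y = ∑ l, if l = y then p y else 0 := by simp
  rw [hsum, plannedStart, finishTime, ← Finset.sum_add_distrib]
  refine Finset.sum_congr rfl fun l _ => ?_
  unfold timeSpent
  by_cases hl : l = y
  · subst hl
    simp only [hy, if_true, le_refl, nextRound_self, timeFinished]
    ring
  · have hne : slot σ (f l) l ≠ slot σ (f y) y := fun h => hl (slot_eq h).2
    simp only [hl, if_false, add_zero]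
    by_cases hlU : l ∈ U
    · have := (hU l).1 hlU
      rw [if_pos hlU, if_neg (not_le.2 (lt_of_le_of_ne this hne.symm))]
    · have := mt (hU l).2 hlU
      rw [if_neg hlU, if_pos (not_le.1 this).le]

/-! ### One transition of the strategy -/

/-- The effect of executing a plan up to the completion of the first job. -/
theorem transition_plan (hb : 1 < b) (hp : ∀ j, 0 < p j) (hw : ∀ j, 0 < w j)
    (hf : ∀ j q, p j ≤ w j * unit b ξ q ↔ f j ≤ q) {s : State n} {R : Fin n → ℤ → Prop}
    {y : Fin n} (hy : y ∈ s.unfinished)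
    (hmin : ∀ k ∈ s.unfinished, slot σ (f y) y ≤ slot σ (f k) k) (hRy : R y (f y))
    (hlow : ∀ k ∈ s.unfinished, k ≠ y →
      s.lower k ≤ w k * unit b ξ (nextRound σ (f y) y k - 1) ∧
      (R k (nextRound σ (f y) y k - 1) ∨
        s.lower k = w k * unit b ξ (nextRound σ (f y) y k - 1))) :
    (transition p s (plan b ξ σ p w f s.unfinished R)).unfinished = s.unfinished.erase y ∧
    (transition p s (plan b ξ σ p w f s.unfinished R)).time =
      plannedStart b ξ σ p w f s.unfinished (f y) y + p y ∧
    ∀ k ∈ s.unfinished, k ≠ y →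
      (transition p s (plan b ξ σ p w f s.unfinished R)).lower k =
        w k * unit b ξ (nextRound σ (f y) y k - 1) := by
  set U := s.unfinished with hU
  set a := plan b ξ σ p w f U R with ha
  set z : Probing n := ⟨plannedStart b ξ σ p w f U (f y) y, y, w y * unit b ξ (f y)⟩ with hz
  -- Any other probing long enough to succeed has a later slot, so it starts only after the window
  -- of `z`. Thus `z` is the unique first completion, which pins down the choice made in
  -- `transition`.
  have hlater : ∀ (q : ℤ) (k : Fin n), k ∈ U → f k ≤ q → ¬ (q = f y ∧ k = y) →
      plannedStart b ξ σ p w f U (f y) y + p y < plannedStart b ξ σ p w f U q k + p k := by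
    intro q k hk hq hne
    have h1 : slot σ (f k) k ≤ slot σ q k := by
      rw [slot_le]; have := le_refl (σ k); omega
    have h2 : slot σ (f y) y < slot σ q k :=
      lt_of_le_of_ne ((hmin k hk).trans h1) fun h => hne ⟨(slot_eq h).1.symm, (slot_eq h).2.symm⟩
    have h3 := plannedStart_add_le (p := p) (f := f) (ξ := ξ) hb hw hy h2
    have h4 := (hf y (f y)).2 le_rfl
    have := hp k
    linarith
  have hfirst : IsFirstCompletion p a z := by
    refine ⟨⟨⟨f y, y, hy, hRy, rfl⟩, (hf y (f y)).2 le_rfl⟩, ?_⟩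
    rintro _ ⟨q, k, hk, -, rfl⟩ hle
    by_cases hne : q = f y ∧ k = y
    · rw [hne.1, hne.2]
    · exact (hlater q k hk ((hf k q).1 hle) hne).le
  have huniq : ∀ x, IsFirstCompletion p a x → x = z := by
    rintro _ ⟨⟨⟨q, k, hk, -, rfl⟩, hle⟩, h⟩
    by_cases hne : q = f y ∧ k = y
    · rw [hne.1, hne.2]
    · exact absurd (h z hfirst.1.1 hfirst.1.2)
        (not_le.2 (hlater q k hk ((hf k q).1 hle) hne))
  have hex : ∃ x, IsFirstCompletion p a x := ⟨z, hfirst⟩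
  unfold transition
  rw [dif_pos hex]
  simp only [huniq _ hex.choose_spec]
  refine ⟨rfl, rfl, fun k hk hky => ?_⟩
  -- The supremum may run over infinitely many rounds. It is attained in the last round in which `k`
  -- is probed before the slot of `y`, either by a probing of this plan or by the inherited bound.
  apply IsGreatest.csSup_eq
  have hstart : ∀ q, plannedStart b ξ σ p w f U q k ≤ plannedStart b ξ σ p w f U (f y) y →
      q ≤ nextRound σ (f y) y k - 1 := by
    intro q h
    rw [Int.le_sub_one_iff, lt_nextRound_iff hky]
    by_contra hlt
    have hne : slot σ (f y) y ≠ slot σ q k := fun h => hky (slot_eq h).2.symm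
    have := plannedStart_add_le (p := p) (f := f) (ξ := ξ) hb hw hy
      (lt_of_le_of_ne (not_lt.1 hlt) hne)
    have := mul_pos (hw y) (unit_pos (ξ := ξ) hb (f y))
    linarith
  have hlt : slot σ (f y) y < slot σ (f k) k :=
    lt_of_le_of_ne (hmin k hk) fun h => hky (slot_eq h).2.symm
  have hfk : nextRound σ (f y) y k - 1 < f k := by
    by_contra h
    have h1 : nextRound σ (f y) y k > f k := by omega
    exact absurd ((lt_nextRound_iff hky).1 h1) hlt.le.not_gt
  -- These rounds precede `f k`, so the probings fail and reveal their full duration.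
  have hmindur : ∀ q, q ≤ nextRound σ (f y) y k - 1 →
      min (w k * unit b ξ q) (p k) = w k * unit b ξ q := by
    intro q hq
    refine min_eq_left (le_of_not_ge fun h => ?_)
    have := (hf k q).1 h
    omega
  refine ⟨?_, ?_⟩
  · rcases (hlow k hk hky).2 with h | h
    · refine Or.inr ⟨_, ⟨nextRound σ (f y) y k - 1, k, hk, h, rfl⟩, ?_, rfl,
        (hmindur _ le_rfl).symm⟩
      have h1 : slot σ (nextRound σ (f y) y k - 1) k < slot σ (f y) y :=
        (lt_nextRound_iff hky).1 (by omega)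
      have := plannedStart_add_le (p := p) (f := f) (ξ := ξ) hb hw hk h1
      have := mul_pos (hw k) (unit_pos (ξ := ξ) hb (nextRound σ (f y) y k - 1))
      simp only [hz]
      linarith
    · exact Or.inl h.symm
  · rintro v (rfl | ⟨_, ⟨q, k', hk', -, rfl⟩, hs, rfl, rfl⟩)
    · exact (hlow k hk hky).1
    · have hq := hstart q hs
      simp only
      rw [hmindur q hq]
      exact mul_le_mul_of_nonneg_left (unit_mono hb hq) (hw _).le

/-- The state `s` is the one reached on the completion of job `x`. -/
structure IsAfter (b ξ : ℝ) (σ : Equiv.Perm (Fin n)) (p w : Fin n → ℝ) (f : Fin n → ℤ)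
    (x : Fin n) (s : State n) : Prop where
  mem_unfinished : ∀ k, k ∈ s.unfinished ↔ slot σ (f x) x < slot σ (f k) k
  time_eq : s.time = finishTime b ξ σ p w f x
  lower_eq : ∀ k ∈ s.unfinished, s.lower k = w k * unit b ξ (nextRound σ (f x) x k - 1)

/-! ### The actions of the strategy as plans -/

theorem weightBefore_eq_sum (J : Finset (Fin n)) (j : Fin n) :
    weightBefore σ w J j = ∑ l, if l ∈ J then (if σ l < σ j then w l else 0) else 0 := by
  rw [weightBefore, Finset.sum_filter, Finset.sum_ite_mem, Finset.univ_inter]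

theorem firstAction_eq_plan (hb : 1 < b) :
    firstAction b σ ξ w = plan b ξ σ p w f Finset.univ fun _ _ => True := by
  have hstart : ∀ (q : ℤ) (j : Fin n), b ^ ((q : ℝ) + ξ) / (b - 1) * ∑ k, w k
      + b ^ ((q : ℝ) + ξ) * weightBefore σ w Finset.univ j =
      plannedStart b ξ σ p w f Finset.univ q j := by
    intro q j
    rw [weightBefore_eq_sum, Finset.mul_sum, Finset.mul_sum, ← Finset.sum_add_distrib,
      plannedStart]
    refine Finset.sum_congr rfl fun l _ => ?_
    simp only [Finset.mem_univ, if_true, nextRound]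
    split_ifs
    · rw [unit_add_one_div hb, unit]; ring
    · rw [unit]; ring
  ext z
  simp only [firstAction, plan, Set.mem_ofPred_eq, hstart, Finset.mem_univ, true_and]
  rfl

theorem lower_eq_iff (hb : 1 < b) (hw : ∀ j, 0 < w j) {x : Fin n} {s : State n}
    (h : IsAfter b ξ σ p w f x s) {k : Fin n} (hk : k ∈ s.unfinished) (q : ℤ) :
    s.lower k = w k * unit b ξ q ↔ nextRound σ (f x) x k - 1 = q := by
  rw [h.lower_eq k hk, mul_right_inj' (hw k).ne', (unit_strictMono hb).injective.eq_iff]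

/-- The current round need not be unique: if all unfinished jobs were last probed in the same round,
both that round and the next one qualify. The planned probings are the same, so the arbitrary choice
in `bScalingAction` is harmless. -/
theorem laterAction_eq_plan (hb : 1 < b) (hw : ∀ j, 0 < w j) {x : Fin n} {s : State n}
    (h : IsAfter b ξ σ p w f x s) {r : ℤ} (hr : IsCurrentRound b ξ w s r) :
    laterAction b σ ξ w s r =
      plan b ξ σ p w f s.unfinished fun k q => nextRound σ (f x) x k ≤ q := by
  have hr' : ∀ k ∈ s.unfinished, nextRound σ (f x) x k = r ∨ nextRound σ (f x) x k = r + 1 := by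
    intro k hk
    have := hr k hk
    rw [unit_sub_one, ← unit, lower_eq_iff hb hw h hk, lower_eq_iff hb hw h hk] at this
    omega
  have hpend : ∀ k, k ∈ pending b ξ w s r ↔ k ∈ s.unfinished ∧ nextRound σ (f x) x k = r := by
    intro k
    unfold pending
    rw [Finset.mem_filter, unit_sub_one]
    refine and_congr_right fun hk => ?_
    rw [lower_eq_iff hb hw h hk]
    omega
  have htime : s.time = ∑ l, if l ∈ s.unfinished
      then w l * (unit b ξ (nextRound σ (f x) x l) / (b - 1)) else timeFinished b ξ p w f l := by
    rw [h.time_eq, finishTime]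
    refine Finset.sum_congr rfl fun l _ => ?_
    by_cases hl : l ∈ s.unfinished
    · rw [timeSpent, if_pos hl, if_neg (not_le.2 ((h.mem_unfinished l).1 hl))]
    · rw [timeSpent, if_neg hl, if_pos (not_lt.1 (mt (h.mem_unfinished l).2 hl))]
  have hstart1 : ∀ k ∈ pending b ξ w s r,
      s.time + b ^ ((r : ℝ) + ξ) * weightBefore σ w (pending b ξ w s r) k =
        plannedStart b ξ σ p w f s.unfinished r k := by
    intro k hk
    rw [htime, weightBefore_eq_sum, Finset.mul_sum, ← Finset.sum_add_distrib, plannedStart]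
    refine Finset.sum_congr rfl fun l _ => ?_
    obtain ⟨-, hk⟩ := (hpend k).1 hk
    by_cases hl : l ∈ s.unfinished
    · rcases hr' l hl with hl' | hl'
      · rw [if_pos hl, if_pos hl, if_pos ((hpend l).2 ⟨hl, hl'⟩), hl', ← unit, nextRound]
        split_ifs
        · rw [unit_add_one_div hb]; ring
        · ring
      · have hlp : l ∉ pending b ξ w s r := fun hc => by
          have := ((hpend l).1 hc).2
          omega
        -- Job `l` has had its probing of round `r` and `k` has not, so `l` precedes `x` in the
        -- order and `k` does not.
        have hlk : σ l < σ k := by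
          have h1 : σ l < σ x := by
            by_contra h1
            unfold nextRound at hk hl'
            split_ifs at hk hl'
            all_goals omega
          have h2 : ¬ σ k < σ x := by
            intro h2
            unfold nextRound at hk hl'
            split_ifs at hk hl'
            omega
          exact lt_of_lt_of_le h1 (not_lt.1 h2)
        rw [if_pos hl, if_pos hl, if_neg hlp, hl', nextRound, if_pos hlk]
        ring
    · have hlp : l ∉ pending b ξ w s r := fun hc => hl ((hpend l).1 hc).1
      rw [if_neg hl, if_neg hl, if_neg hlp]
      ring
  have hstart2 : ∀ (q : ℤ) (k : Fin n),
      roundStart b ξ w s r q + b ^ ((q : ℝ) + ξ) * weightBefore σ w s.unfinished k =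
        plannedStart b ξ σ p w f s.unfinished q k := by
    intro q k
    have hr1 : b ^ ((r : ℝ) + 1 + ξ) = unit b ξ (r + 1) := by simp [unit]
    have hsum : ∀ (J : Finset (Fin n)), ∑ k ∈ J, w k = ∑ l, if l ∈ J then w l else 0 := by
      intro J
      simp
    rw [roundStart, htime, weightBefore_eq_sum, hsum, hsum, hr1, ← unit, ← unit, Finset.mul_sum,
      Finset.mul_sum, Finset.mul_sum, ← Finset.sum_add_distrib, ← Finset.sum_add_distrib,
      ← Finset.sum_add_distrib, plannedStart]
    refine Finset.sum_congr rfl fun l _ => ?_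
    have hq : w l * (unit b ξ (nextRound σ q k l) / (b - 1)) =
        w l * (unit b ξ q / (b - 1)) + unit b ξ q * (if σ l < σ k then w l else 0) := by
      unfold nextRound
      split_ifs
      · rw [unit_add_one_div hb]; ring
      · ring
    by_cases hl : l ∈ s.unfinished
    · rw [if_pos hl, if_pos hl, if_pos hl, if_pos hl, hq, sub_div]
      rcases hr' l hl with hl' | hl'
      · rw [if_pos ((hpend l).2 ⟨hl, hl'⟩), hl', unit_add_one_div hb]
        ring
      · rw [if_neg (fun hc => by have := ((hpend l).1 hc).2; omega), hl']
        ring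
    · rw [if_neg hl, if_neg hl, if_neg hl, if_neg hl, if_neg fun hc => hl ((hpend l).1 hc).1]
      ring
  ext z
  constructor
  · rintro (⟨k, hk, rfl⟩ | ⟨q, hq, k, hk, rfl⟩)
    · refine ⟨r, k, ((hpend k).1 hk).1, ((hpend k).1 hk).2.le, ?_⟩
      rw [hstart1 k hk, ← unit]
    · refine ⟨q, k, hk, ?_, ?_⟩
      · have := hr' k hk
        dsimp only
        omega
      · rw [hstart2, ← unit]
  · rintro ⟨q, k, hk, hq, rfl⟩
    have := hr' k hk
    by_cases hrq : r < q
    · refine Or.inr ⟨q, hrq, k, hk, ?_⟩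
      rw [hstart2, ← unit]
    · have hkr : nextRound σ (f x) x k = r := by omega
      have hqr : q = r := by omega
      subst hqr
      have hk' := (hpend k).2 ⟨hk, hkr⟩
      refine Or.inl ⟨k, hk', ?_⟩
      rw [hstart1 k hk', ← unit]

theorem IsAfter.isCurrentRound {x : Fin n} {s : State n} (h : IsAfter b ξ σ p w f x s) :
    IsCurrentRound b ξ w s (f x) := by
  intro k hk
  rw [h.lower_eq k hk, unit_sub_one, ← unit, nextRound]
  split_ifs
  · right; simp
  · left; rfl

theorem bScalingAction_eq_plan (hb : 1 < b) (hw : ∀ j, 0 < w j) {x : Fin n} {s : State n}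
    (h : IsAfter b ξ σ p w f x s) :
    bScalingAction b σ ξ w s =
      plan b ξ σ p w f s.unfinished fun k q => nextRound σ (f x) x k ≤ q := by
  have hne : s ≠ initialState n := by
    rintro rfl
    have := (h.mem_unfinished x).1 (Finset.mem_univ x)
    exact lt_irrefl _ this
  have hex : ∃ r, IsCurrentRound b ξ w s r := ⟨f x, h.isCurrentRound⟩
  rw [bScalingAction, if_neg hne, dif_pos hex]
  exact laterAction_eq_plan hb hw h hex.choose_spec

/-! ### From completion to completion -/

theorem isAfter_transition_initialState (hb : 1 < b) (hp : ∀ j, 0 < p j) (hw : ∀ j, 0 < w j)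
    (hf : ∀ j q, p j ≤ w j * unit b ξ q ↔ f j ≤ q) {y : Fin n}
    (hy : ∀ k, slot σ (f y) y ≤ slot σ (f k) k) :
    IsAfter b ξ σ p w f y
      (transition p (initialState n) (bScalingAction b σ ξ w (initialState n))) := by
  have ha : bScalingAction b σ ξ w (initialState n) =
      plan b ξ σ p w f (initialState n).unfinished fun _ _ => True := by
    rw [bScalingAction, if_pos rfl]
    exact firstAction_eq_plan hb
  rw [ha]
  obtain ⟨h1, h2, h3⟩ := transition_plan (σ := σ) (R := fun _ _ => True) hb hp hw hf
    (s := initialState n) (y := y) (Finset.mem_univ y) (fun k _ => hy k) trivial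
    (fun k _ _ => ⟨(mul_pos (hw k) (unit_pos hb _)).le, Or.inl trivial⟩)
  have hmem : ∀ k, k ≠ y ↔ slot σ (f y) y < slot σ (f k) k := fun k =>
    ⟨fun hk => lt_of_le_of_ne (hy k) fun h => hk (slot_eq h).2.symm, by
      rintro h rfl
      exact lt_irrefl _ h⟩
  refine ⟨fun k => ?_, ?_, fun k hk => ?_⟩
  · rw [h1, ← hmem]
    simp [initialState]
  · rw [h2]
    exact plannedStart_add_eq_finishTime (Finset.mem_univ y) fun k => by
      simp [initialState, hy k]
  · rw [h1] at hk
    exact h3 k (Finset.mem_univ k) (Finset.mem_erase.1 hk).1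

/-- The inductive step, with `y` the next job in slot order after `x`. A job not probed between the
two completions keeps its old lower bound; the others get theirs from the current plan. -/
theorem IsAfter.transition (hb : 1 < b) (hp : ∀ j, 0 < p j) (hw : ∀ j, 0 < w j)
    (hf : ∀ j q, p j ≤ w j * unit b ξ q ↔ f j ≤ q) {x y : Fin n} {s : State n}
    (h : IsAfter b ξ σ p w f x s) (hxy : slot σ (f x) x < slot σ (f y) y)
    (hy : ∀ k, slot σ (f x) x < slot σ (f k) k → slot σ (f y) y ≤ slot σ (f k) k) :
    IsAfter b ξ σ p w f y (transition p s (bScalingAction b σ ξ w s)) := by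
  rw [bScalingAction_eq_plan hb hw h]
  have hyU := (h.mem_unfinished y).2 hxy
  have hnext : ∀ k, k ≠ x → slot σ (f x) x < slot σ (f k) k → nextRound σ (f x) x k ≤ f k := by
    intro k hk hlt
    by_contra hc
    exact absurd ((lt_nextRound_iff hk).1 (not_le.1 hc)) hlt.le.not_gt
  have hyx : y ≠ x := by
    rintro rfl
    exact lt_irrefl _ hxy
  obtain ⟨h1, h2, h3⟩ := transition_plan (σ := σ) (s := s) (y := y)
    (R := fun k q => nextRound σ (f x) x k ≤ q) hb hp hw hf hyU
    (fun k hk => hy k ((h.mem_unfinished k).1 hk)) (hnext y hyx hxy) (by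
      intro k hk hky
      have hm := nextRound_mono hxy k
      rw [h.lower_eq k hk]
      refine ⟨mul_le_mul_of_nonneg_left (unit_mono hb (by omega)) (hw k).le, ?_⟩
      rcases hm.eq_or_lt with hm | hm
      · right
        rw [hm]
      · left
        omega)
  have hmem : ∀ k, k ∈ s.unfinished ↔ slot σ (f y) y ≤ slot σ (f k) k := fun k =>
    ⟨fun hk => hy k ((h.mem_unfinished k).1 hk), fun hk =>
      (h.mem_unfinished k).2 (hxy.trans_le hk)⟩
  refine ⟨fun k => ?_, ?_, fun k hk => ?_⟩
  · rw [h1, Finset.mem_erase, hmem]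
    refine ⟨fun hk => lt_of_le_of_ne hk.2 fun h => hk.1 (slot_eq h).2.symm, fun hk => ⟨?_, hk.le⟩⟩
    rintro rfl
    exact lt_irrefl _ hk
  · rw [h2]
    exact plannedStart_add_eq_finishTime hyU hmem
  · rw [h1] at hk
    exact h3 k (Finset.mem_erase.1 hk).2 (Finset.mem_erase.1 hk).1

theorem IsAfter.transition_eq_self (hb : 1 < b) (hw : ∀ j, 0 < w j) {x : Fin n} {s : State n}
    (h : IsAfter b ξ σ p w f x s) (hs : s.unfinished = ∅) :
    KillRestart.transition p s (bScalingAction b σ ξ w s) = s := by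
  rw [bScalingAction_eq_plan hb hw h]
  unfold KillRestart.transition
  rw [dif_neg]
  rintro ⟨_, ⟨⟨q, k, hk, -⟩, -⟩, -⟩
  rw [hs] at hk
  exact absurd hk (Finset.notMem_empty k)

theorem stateAfter_succ_isAfter (hb : 1 < b) (hp : ∀ j, 0 < p j) (hw : ∀ j, 0 < w j)
    (hf : ∀ j q, p j ≤ w j * unit b ξ q ↔ f j ≤ q) [Nonempty (Fin n)] (m : ℕ) :
    ∃ x, IsAfter b ξ σ p w f x (stateAfter (bScaling b hb σ ξ w hw) p (m + 1)) := by
  induction m with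
  | zero =>
    obtain ⟨y, -, hy⟩ := Finset.exists_min_image Finset.univ (fun k => slot σ (f k) k)
      Finset.univ_nonempty
    exact ⟨y, isAfter_transition_initialState hb hp hw hf fun k => hy k (Finset.mem_univ k)⟩
  | succ m ih =>
    obtain ⟨x, hx⟩ := ih
    rw [stateAfter]
    set s := stateAfter (bScaling b hb σ ξ w hw) p (m + 1)
    rcases s.unfinished.eq_empty_or_nonempty with hs | hs
    · refine ⟨x, ?_⟩
      have := hx.transition_eq_self hb hw hs
      rwa [← this] at hx
    · obtain ⟨y, hyU, hy⟩ := Finset.exists_min_image s.unfinished (fun k => slot σ (f k) k) hs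
      exact ⟨y, hx.transition hb hp hw hf ((hx.mem_unfinished y).1 hyU)
        fun k hk => hy k ((hx.mem_unfinished k).2 hk)⟩

/-- Induction on the number of jobs with an earlier finishing slot, stepping from the last of them
to `j`. -/
theorem exists_stateAfter_isAfter (hb : 1 < b) (hp : ∀ j, 0 < p j) (hw : ∀ j, 0 < w j)
    (hf : ∀ j q, p j ≤ w j * unit b ξ q ↔ f j ≤ q) (j : Fin n) :
    ∃ m, IsAfter b ξ σ p w f j (stateAfter (bScaling b hb σ ξ w hw) p m) := by
  have key : ∀ (N : ℕ) (j : Fin n),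
      (Finset.univ.filter fun k => slot σ (f k) k < slot σ (f j) j).card = N →
      ∃ m, IsAfter b ξ σ p w f j (stateAfter (bScaling b hb σ ξ w hw) p m) := by
    intro N
    induction N using Nat.strong_induction_on with
    | _ N ih =>
      intro j hN
      set J := Finset.univ.filter fun k => slot σ (f k) k < slot σ (f j) j with hJ
      rcases J.eq_empty_or_nonempty with hE | hE
      · refine ⟨1, isAfter_transition_initialState hb hp hw hf fun k => not_lt.1 fun hk => ?_⟩
        have : k ∈ J := by simp [hJ, hk]
        rw [hE] at this
        exact absurd this (Finset.notMem_empty k)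
      · obtain ⟨x, hxJ, hx⟩ := Finset.exists_max_image J (fun k => slot σ (f k) k) hE
        have hxj : slot σ (f x) x < slot σ (f j) j := (Finset.mem_filter.1 hxJ).2
        obtain ⟨m, hm⟩ := ih _ (by
          rw [← hN]
          refine Finset.card_lt_card (Finset.ssubset_iff_of_subset ?_ |>.2 ⟨x, hxJ, by simp⟩)
          intro k hk
          simp only [hJ, Finset.mem_filter, Finset.mem_univ, true_and] at hk ⊢
          exact hk.trans hxj) x rfl
        refine ⟨m + 1, hm.transition hb hp hw hf hxj fun k hk => not_lt.1 fun hkj => ?_⟩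
        exact absurd (hx k (by simp [hJ, hkj])) (not_le.2 hk)
  exact key _ j rfl

/-- The state right after `j` attains the infimum: every state without `j` comes after the
completion of a job whose slot is not earlier, and `finishTime_mono` applies. -/
theorem completionTime_bScaling (hb : 1 < b) (hp : ∀ j, 0 < p j) (hw : ∀ j, 0 < w j)
    (hf : ∀ j q, p j ≤ w j * unit b ξ q ↔ f j ≤ q) (j : Fin n) :
    completionTime (bScaling b hb σ ξ w hw) p j =
      ENNReal.ofReal (finishTime b ξ σ p w f j) := by
  have : Nonempty (Fin n) := ⟨j⟩
  apply le_antisymm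
  · obtain ⟨m, hm⟩ := exists_stateAfter_isAfter (σ := σ) hb hp hw hf j
    refine iInf₂_le_of_le m ?_ (by rw [hm.time_eq])
    rw [hm.mem_unfinished]
    exact lt_irrefl _
  · refine le_iInf₂ fun m hm => ENNReal.ofReal_le_ofReal ?_
    cases m with
    | zero => exact absurd (Finset.mem_univ j) hm
    | succ m =>
      obtain ⟨x, hx⟩ := stateAfter_succ_isAfter (σ := σ) hb hp hw hf m
      rw [hx.time_eq]
      rw [hx.mem_unfinished, not_lt] at hm
      rcases hm.eq_or_lt with h | h
      · rw [(slot_eq h).2]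
      · exact finishTime_mono hb hp hw h

theorem timeFinished_pos (hb : 1 < b) (hp : ∀ j, 0 < p j) (hw : ∀ j, 0 < w j) (l : Fin n) :
    0 < timeFinished b ξ p w f l := by
  have hb' : 0 < b - 1 := by linarith
  have := hp l
  have := mul_pos (hw l) (div_pos (unit_pos (ξ := ξ) hb (f l)) hb')
  unfold timeFinished
  linarith

theorem timeSpent_pos (hb : 1 < b) (hp : ∀ j, 0 < p j) (hw : ∀ j, 0 < w j) (j l : Fin n) :
    0 < timeSpent b ξ σ p w f j l := by
  have hb' : 0 < b - 1 := by linarith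
  unfold timeSpent
  split_ifs
  · exact timeFinished_pos hb hp hw l
  · exact mul_pos (hw l) (div_pos (unit_pos hb _) hb')

theorem cost_bScaling (hb : 1 < b) (hp : ∀ j, 0 < p j) (hw : ∀ j, 0 < w j)
    (hf : ∀ j q, p j ≤ w j * unit b ξ q ↔ f j ≤ q) :
    cost (bScaling b hb σ ξ w hw) p w =
      ENNReal.ofReal (∑ j, ∑ k, w j * timeSpent b ξ σ p w f j k) := by
  have hnn : ∀ j k, 0 ≤ w j * timeSpent b ξ σ p w f j k := fun j k =>
    (mul_pos (hw j) (timeSpent_pos hb hp hw j k)).le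
  rw [cost, ENNReal.ofReal_sum_of_nonneg fun j _ => Finset.sum_nonneg fun k _ => hnn j k]
  refine Finset.sum_congr rfl fun j _ => ?_
  rw [completionTime_bScaling hb hp hw hf, ← ENNReal.ofReal_mul (hw j).le, finishTime,
    Finset.mul_sum]

end Simulation

/-! ### Quadratic forms of the `min` kernel -/

section QuadraticForms

open MeasureTheory

variable {ι : Type*} [Fintype ι]

/-- The kernel `min` on the nonnegative reals is positive semidefinite. -/
theorem sum_mul_min_nonneg (c x : ι → ℝ) (hx : ∀ i, 0 ≤ x i) :
    0 ≤ ∑ i, ∑ j, c i * c j * min (x i) (x j) := by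
  -- `min (x i) (x j)` is the `L²` inner product of the indicators of `(0, x i]` and `(0, x j]`, so
  -- the form is the integral of a square.
  set g : ι → ℝ → ℝ := fun i => (Set.Ioc 0 (x i)).indicator fun _ => 1 with hg
  have hmul : ∀ i j, (fun t => g i t * g j t) =
      (Set.Ioc 0 (min (x i) (x j))).indicator fun _ => (1 : ℝ) := by
    intro i j
    ext t
    simp only [hg, Set.indicator_apply, Set.mem_Ioc, le_min_iff]
    split_ifs <;> simp_all
  have hint : ∀ i j, ∫ t, g i t * g j t = min (x i) (x j) := by
    intro i j
    rw [hmul, integral_indicator measurableSet_Ioc]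
    simp [hx i, hx j]
  have hintb : ∀ i j, Integrable fun t => g i t * g j t := by
    intro i j
    rw [hmul, integrable_indicator_iff measurableSet_Ioc]
    exact integrableOn_const (by simp)
  have hintc : ∀ i j, Integrable fun t => c i * g i t * (c j * g j t) := by
    intro i j
    refine ((hintb i j).const_mul (c i * c j)).congr (ae_of_all _ fun t => ?_)
    dsimp only
    ring
  have h : ∑ i, ∑ j, c i * c j * min (x i) (x j) = ∫ t, (∑ i, c i * g i t) ^ 2 := by
    simp_rw [sq, Finset.sum_mul_sum, ← hint, ← integral_const_mul]
    rw [integral_finsetSum _ fun i _ => integrable_finsetSum _ fun j _ => hintc i j]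
    refine Finset.sum_congr rfl fun i _ => ?_
    rw [integral_finsetSum _ fun j _ => hintc i j]
    refine Finset.sum_congr rfl fun j _ => integral_congr_ae (ae_of_all _ fun t => ?_)
    dsimp only
    ring
  rw [h]
  exact integral_nonneg fun t => sq_nonneg _

/-- Positivity is applied to the doubled family of points `x i` with coefficient `w i` and `μ ^ 2 *
x i` with coefficient `-w i / μ`. By homogeneity both diagonal blocks equal the form of `min`, and
the two cross blocks are each `-1 / μ` times the left-hand side. -/
theorem sum_mul_min_scale_le (w x : ι → ℝ) (hx : ∀ i, 0 ≤ x i) {μ : ℝ} (hμ : 0 < μ) :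
    ∑ i, ∑ j, w i * w j * min (x i) (μ ^ 2 * x j) ≤
      μ * ∑ i, ∑ j, w i * w j * min (x i) (x j) := by
  have h := sum_mul_min_nonneg (ι := ι ⊕ ι) (Sum.elim w fun i => -(μ⁻¹ * w i))
    (Sum.elim x fun i => μ ^ 2 * x i) (by
      rintro (i | i)
      · exact hx i
      · exact mul_nonneg (sq_nonneg _) (hx i))
  simp only [Fintype.sum_sum_type, Sum.elim_inl, Sum.elim_inr, Finset.sum_add_distrib] at h
  have h2 : ∑ i, ∑ j, w i * -(μ⁻¹ * w j) * min (x i) (μ ^ 2 * x j) =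
      -μ⁻¹ * ∑ i, ∑ j, w i * w j * min (x i) (μ ^ 2 * x j) := by
    simp_rw [Finset.mul_sum]
    refine Finset.sum_congr rfl fun i _ => Finset.sum_congr rfl fun j _ => by ring
  have h3 : ∑ i, ∑ j, -(μ⁻¹ * w i) * w j * min (μ ^ 2 * x i) (x j) =
      -μ⁻¹ * ∑ i, ∑ j, w i * w j * min (x i) (μ ^ 2 * x j) := by
    rw [Finset.sum_comm]
    simp_rw [Finset.mul_sum]
    refine Finset.sum_congr rfl fun i _ => Finset.sum_congr rfl fun j _ => ?_
    rw [min_comm]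
    ring
  have h4 : ∑ i, ∑ j, -(μ⁻¹ * w i) * -(μ⁻¹ * w j) * min (μ ^ 2 * x i) (μ ^ 2 * x j) =
      ∑ i, ∑ j, w i * w j * min (x i) (x j) := by
    refine Finset.sum_congr rfl fun i _ => Finset.sum_congr rfl fun j _ => ?_
    rw [← mul_min_of_nonneg _ _ (sq_nonneg μ)]
    field_simp
  rw [h2, h3, h4] at h
  set B := ∑ i, ∑ j, w i * w j * min (x i) (μ ^ 2 * x j)
  have h5 : μ⁻¹ * B ≤ ∑ i, ∑ j, w i * w j * min (x i) (x j) := by linarith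
  rwa [inv_mul_le_iff₀ hμ] at h5

/-! ### The pair kernel: mixture form and closed forms -/

/-- The expected cost, per product of their weights, that two jobs cause each other when their
ratios of processing time and weight are `x` and `y`. -/
def pairKernel (b x y : ℝ) : ℝ :=
  (Real.log b)⁻¹ * (min x y + (2 * b)⁻¹ * (min x (b * y) + b * min x (b⁻¹ * y))
    + 2⁻¹ * ∫ s in -Real.log b..Real.log b, (Real.exp s + 1) * min x (Real.exp (-s) * y))

/-- Exchanging `x` and `y` swaps the two scaled terms and reflects the integral under `s ↦ -s`. -/
theorem pairKernel_comm {b : ℝ} (hb : 1 < b) (x y : ℝ) : pairKernel b x y = pairKernel b y x := by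
  have hb0 : 0 < b := by linarith
  have h1 : b * min x (b⁻¹ * y) = min y (b * x) := by
    rw [mul_min_of_nonneg _ _ hb0.le, min_comm, mul_inv_cancel_left₀ hb0.ne']
  have h2 : b * min y (b⁻¹ * x) = min x (b * y) := by
    rw [mul_min_of_nonneg _ _ hb0.le, min_comm, mul_inv_cancel_left₀ hb0.ne']
  have h3 : ∫ s in -Real.log b..Real.log b, (Real.exp s + 1) * min x (Real.exp (-s) * y) =
      ∫ s in -Real.log b..Real.log b, (Real.exp s + 1) * min y (Real.exp (-s) * x) := by
    have := intervalIntegral.integral_comp_neg (a := -Real.log b) (b := Real.log b)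
      fun s => (Real.exp s + 1) * min y (Real.exp (-s) * x)
    rw [neg_neg] at this
    rw [← this]
    refine intervalIntegral.integral_congr fun s _ => ?_
    have h4 : min x (Real.exp (-s) * y) = Real.exp (-s) * min y (Real.exp s * x) := by
      rw [mul_min_of_nonneg _ _ (Real.exp_pos _).le, ← mul_assoc, ← Real.exp_add]
      simp [min_comm]
    have h5 : Real.exp s * Real.exp (-s) = 1 := by rw [← Real.exp_add]; simp
    rw [h4, neg_neg]
    linear_combination (min y (Real.exp s * x)) * h5
  rw [pairKernel, pairKernel, h1, h2, h3, min_comm x y, add_comm (min x (b * y))]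

/-- The integral is split at `s = log (y / x)`, where the minimum changes branch. The closed forms
link the mixture to the expected delay computed in `integral_ite_eq_pairKernel`. -/
theorem pairKernel_eq_of_le_mul {b x y : ℝ} (hb : 1 < b) (hx : 0 < x) (hxy : x ≤ y)
    (hyx : y ≤ b * x) :
    pairKernel b x y = (y + 3 * x + Real.log b * (x + y) - (y - x) * Real.log (y / x)) /
      (2 * Real.log b) := by
  have hb0 : 0 < b := by linarith
  have hL : 0 < Real.log b := Real.log_pos hb
  have hy : 0 < y := hx.trans_le hxy
  set L := Real.log b with hLdef
  set v := Real.log (y / x) with hv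
  have hev : Real.exp v = y / x := Real.exp_log (div_pos hy hx)
  have heL : Real.exp L = b := Real.exp_log hb0
  have hint : ∀ a c, IntervalIntegrable
      (fun s => (Real.exp s + 1) * min x (Real.exp (-s) * y)) volume a c := fun a c =>
    Continuous.intervalIntegrable (by fun_prop) a c
  have h1 : ∫ s in -L..v, (Real.exp s + 1) * min x (Real.exp (-s) * y) =
      x * (y / x - b⁻¹ + v + L) := by
    have hvL : -L ≤ v := by
      have : 0 ≤ v := Real.log_nonneg ((one_le_div hx).2 hxy)
      linarith
    have : Set.EqOn (fun s => (Real.exp s + 1) * min x (Real.exp (-s) * y))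
        (fun s => x * (Real.exp s + 1)) (Set.uIcc (-L) v) := by
      intro s hs
      rw [Set.uIcc_of_le hvL] at hs
      have h : x ≤ Real.exp (-s) * y := by
        rw [Real.exp_neg, ← div_eq_inv_mul, le_div_iff₀ (Real.exp_pos _), mul_comm,
          ← le_div_iff₀ hx, ← hev]
        exact Real.exp_le_exp.2 hs.2
      dsimp only
      rw [min_eq_left h]
      ring
    rw [intervalIntegral.integral_congr this, intervalIntegral.integral_const_mul,
      intervalIntegral.integral_add (Continuous.intervalIntegrable (by fun_prop) _ _)
        (Continuous.intervalIntegrable (by fun_prop) _ _), integral_exp,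
      intervalIntegral.integral_const, Real.exp_neg, hev, heL, smul_eq_mul]
    ring
  have h2 : ∫ s in v..L, (Real.exp s + 1) * min x (Real.exp (-s) * y) =
      y * (L - v + x / y - b⁻¹) := by
    have hvL : v ≤ L := Real.log_le_log (div_pos hy hx) ((div_le_iff₀ hx).2 hyx)
    have : Set.EqOn (fun s => (Real.exp s + 1) * min x (Real.exp (-s) * y))
        (fun s => y * (1 + Real.exp (-s))) (Set.uIcc v L) := by
      intro s hs
      rw [Set.uIcc_of_le hvL] at hs
      have h : Real.exp (-s) * y ≤ x := by
        rw [Real.exp_neg, ← div_eq_inv_mul, div_le_iff₀ (Real.exp_pos _), mul_comm,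
          ← div_le_iff₀ hx, ← hev]
        exact Real.exp_le_exp.2 hs.1
      have h5 : Real.exp s * Real.exp (-s) = 1 := by rw [← Real.exp_add]; simp
      dsimp only
      rw [min_eq_right h]
      linear_combination y * h5
    rw [intervalIntegral.integral_congr this, intervalIntegral.integral_const_mul,
      intervalIntegral.integral_add (Continuous.intervalIntegrable (by fun_prop) _ _)
        (Continuous.intervalIntegrable (by fun_prop) _ _),
      intervalIntegral.integral_comp_neg Real.exp, integral_exp,
      intervalIntegral.integral_const, Real.exp_neg, Real.exp_neg, hev, heL, smul_eq_mul, inv_div]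
    ring
  have h3 : min x (b * y) = x := min_eq_left (by nlinarith)
  have h4 : b * min x (b⁻¹ * y) = y := by
    rw [mul_min_of_nonneg _ _ hb0.le, mul_inv_cancel_left₀ hb0.ne', min_eq_right hyx]
  rw [pairKernel, ← hLdef, h3, h4, min_eq_left hxy,
    ← intervalIntegral.integral_add_adjacent_intervals (hint _ v) (hint v _), h1, h2]
  field_simp
  ring

theorem pairKernel_eq_of_mul_le {b x y : ℝ} (hb : 1 < b) (hx : 0 < x) (hyx : b * x ≤ y) :
    pairKernel b x y = x * (1 + (b + 3) / (2 * Real.log b)) := by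
  have hb0 : 0 < b := by linarith
  have hL : 0 < Real.log b := Real.log_pos hb
  have hxy : x ≤ y := by nlinarith
  have heL : Real.exp (Real.log b) = b := Real.exp_log hb0
  have h1 : ∫ s in -Real.log b..Real.log b, (Real.exp s + 1) * min x (Real.exp (-s) * y) =
      x * (b - b⁻¹ + 2 * Real.log b) := by
    have : Set.EqOn (fun s => (Real.exp s + 1) * min x (Real.exp (-s) * y))
        (fun s => x * (Real.exp s + 1)) (Set.uIcc (-Real.log b) (Real.log b)) := by
      intro s hs
      rw [Set.uIcc_of_le (by linarith)] at hs
      have h : x ≤ Real.exp (-s) * y := by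
        rw [Real.exp_neg, ← div_eq_inv_mul, le_div_iff₀ (Real.exp_pos _), mul_comm]
        refine le_trans (mul_le_mul_of_nonneg_right ?_ hx.le) hyx
        rw [← heL]
        exact Real.exp_le_exp.2 hs.2
      dsimp only
      rw [min_eq_left h]
      ring
    rw [intervalIntegral.integral_congr this, intervalIntegral.integral_const_mul,
      intervalIntegral.integral_add (Continuous.intervalIntegrable (by fun_prop) _ _)
        (Continuous.intervalIntegrable (by fun_prop) _ _), integral_exp,
      intervalIntegral.integral_const, Real.exp_neg, heL, smul_eq_mul]
    ring
  have h3 : min x (b * y) = x := min_eq_left (by nlinarith)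
  have h4 : b * min x (b⁻¹ * y) = b * x := by
    rw [mul_min_of_nonneg _ _ hb0.le, mul_inv_cancel_left₀ hb0.ne', min_eq_left hyx]
  rw [pairKernel, h3, h4, min_eq_left hxy, h1]
  field_simp
  ring

/-- Each kernel `min x (c * y)` costs a factor `√c`; over the mixture these add up to `(1 + 1 / √b +
2 * (√b - 1 / √b)) / log b`, which is the ratio. -/
theorem sum_mul_pairKernel_le {b : ℝ} (hb : 1 < b) (w x : ι → ℝ) (hx : ∀ i, 0 ≤ x i) :
    ∑ i, ∑ j, w i * w j * pairKernel b (x i) (x j) ≤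
      (√b + 2 * b - 1) / (√b * Real.log b) * ∑ i, ∑ j, w i * w j * min (x i) (x j) := by
  have hb0 : 0 < b := by linarith
  have hL : 0 < Real.log b := Real.log_pos hb
  have hs : 0 < √b := Real.sqrt_pos.2 hb0
  have hsq : √b ^ 2 = b := Real.sq_sqrt hb0.le
  have hexp : Real.exp (Real.log b / 2) = √b := by
    rw [Real.exp_half, Real.exp_log hb0]
  set L := Real.log b with hLdef
  set Q := ∑ i, ∑ j, w i * w j * min (x i) (x j) with hQ
  have h1 : ∑ i, ∑ j, w i * w j * min (x i) (b * x j) ≤ √b * Q := by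
    have := sum_mul_min_scale_le w x hx hs
    rwa [hsq] at this
  have h2 : ∑ i, ∑ j, w i * w j * min (x i) (b⁻¹ * x j) ≤ (√b)⁻¹ * Q := by
    have := sum_mul_min_scale_le w x hx (inv_pos.2 hs)
    rwa [inv_pow, hsq] at this
  have h3 : ∑ i, ∑ j, w i * w j * (∫ s in -L..L, (Real.exp s + 1) * min (x i) (Real.exp (-s) * x j))
      ≤ 4 * (√b - (√b)⁻¹) * Q := by
    have e1 : ∑ i, ∑ j, w i * w j *
        (∫ s in -L..L, (Real.exp s + 1) * min (x i) (Real.exp (-s) * x j)) =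
        ∫ s in -L..L, (Real.exp s + 1) *
          ∑ i, ∑ j, w i * w j * min (x i) (Real.exp (-s) * x j) := by
      simp_rw [Finset.mul_sum]
      rw [intervalIntegral.integral_finsetSum
        fun i _ => Continuous.intervalIntegrable (by fun_prop) _ _]
      refine Finset.sum_congr rfl fun i _ => ?_
      rw [intervalIntegral.integral_finsetSum
        fun i _ => Continuous.intervalIntegrable (by fun_prop) _ _]
      refine Finset.sum_congr rfl fun j _ => ?_
      rw [← intervalIntegral.integral_const_mul]
      refine intervalIntegral.integral_congr fun s _ => ?_
      ring
    have e2 : ∫ s in -L..L, (Real.exp (s / 2) + Real.exp (-s / 2)) * Q =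
        4 * (√b - (√b)⁻¹) * Q := by
      rw [intervalIntegral.integral_mul_const]
      congr 1
      have hd : ∀ s ∈ Set.uIcc (-L) L, HasDerivAt
          (fun s => 2 * Real.exp (s / 2) - 2 * Real.exp (-s / 2))
          (Real.exp (s / 2) + Real.exp (-s / 2)) s := by
        intro s _
        have d1 := (((hasDerivAt_id s).div_const 2).exp).const_mul 2
        have d2 := (((hasDerivAt_id s).neg.div_const 2).exp).const_mul 2
        refine (d1.sub d2).congr_deriv ?_
        simp only [id, Pi.neg_apply]
        ring
      rw [intervalIntegral.integral_eq_sub_of_hasDerivAt hd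
        (Continuous.intervalIntegrable (by fun_prop) _ _), neg_neg, neg_div, Real.exp_neg, hexp]
      ring
    rw [e1, ← e2]
    refine intervalIntegral.integral_mono_on (by linarith)
      (Continuous.intervalIntegrable (by fun_prop) _ _)
      (Continuous.intervalIntegrable (by fun_prop) _ _) fun s _ => ?_
    -- With `μ = exp (-s / 2)` the integrand is bounded via `(exp s + 1) * μ = exp (s / 2) + exp (-s
    -- / 2)`.
    have h := sum_mul_min_scale_le w x hx (Real.exp_pos (-s / 2))
    have e3 : Real.exp (-s / 2) ^ 2 = Real.exp (-s) := by
      rw [sq, ← Real.exp_add]; ring_nf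
    have e4 : Real.exp s * Real.exp (-s / 2) = Real.exp (s / 2) := by
      rw [← Real.exp_add]; ring_nf
    rw [e3] at h
    have := mul_le_mul_of_nonneg_left h (add_pos (Real.exp_pos s) one_pos).le
    refine this.trans_eq ?_
    rw [← e4]
    ring
  have hsplit : ∑ i, ∑ j, w i * w j * pairKernel b (x i) (x j) =
      L⁻¹ * (Q + (2 * b)⁻¹ * (∑ i, ∑ j, w i * w j * min (x i) (b * x j) +
        b * ∑ i, ∑ j, w i * w j * min (x i) (b⁻¹ * x j)) + 2⁻¹ * ∑ i, ∑ j, w i * w j *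
        (∫ s in -L..L, (Real.exp s + 1) * min (x i) (Real.exp (-s) * x j))) := by
    simp only [hQ, Finset.mul_sum, ← Finset.sum_add_distrib]
    refine Finset.sum_congr rfl fun i _ => Finset.sum_congr rfl fun j _ => ?_
    rw [pairKernel]
    ring
  have hc : (√b + 2 * b - 1) / (√b * L) * Q =
      L⁻¹ * (Q + (2 * b)⁻¹ * (√b * Q + b * ((√b)⁻¹ * Q)) + 2⁻¹ * (4 * (√b - (√b)⁻¹) * Q)) := by
    have hb2 : b = √b ^ 2 := hsq.symm
    generalize √b = r at hs hb2
    subst hb2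
    field_simp
    ring
  rw [hsplit, hc]
  gcongr

end QuadraticForms

/-! ### Minimizing the ratio -/

section Ratio

theorem log_twenty_div_seven_gt : 1.0497 < Real.log (20 / 7) := by
  -- `(20 / 7) ^ 2` is close to `8`, so the known digits of `log 2` and a first-order bound suffice.
  have e : 2 * Real.log (20 / 7) = 3 * Real.log 2 + Real.log (50 / 49) := by
    rw [← Nat.cast_ofNat (n := 2), ← Nat.cast_ofNat (n := 3), ← Real.log_pow, ← Real.log_pow,
      ← Real.log_mul (by norm_num) (by norm_num)]
    norm_num
  have h := Real.one_sub_inv_le_log_of_pos (x := 50 / 49) (by norm_num)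
  have h2 := Real.log_two_gt_d9
  norm_num at h h2 ⊢
  linarith

/-- The equation is the stationarity condition of the ratio in `s = √b`. The end points are chosen
so that their squares lie within `0.005` of `8.16`. -/
theorem exists_log_eq :
    ∃ s : ℝ, 2.8557 ≤ s ∧ s ≤ 20 / 7 ∧ Real.log s = (2 * s ^ 2 + s - 1) / (2 * s ^ 2 + 1) := by
  have hcont : ContinuousOn (fun s : ℝ => Real.log s - (2 * s ^ 2 + s - 1) / (2 * s ^ 2 + 1))
      (Set.Icc 2.8557 (20 / 7)) := by
    refine ContinuousOn.sub (Real.continuousOn_log.mono fun s hs => ?_) (ContinuousOn.div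
      (by fun_prop) (by fun_prop) fun s _ => by positivity)
    have : (0 : ℝ) < s := lt_of_lt_of_le (by norm_num) hs.1
    exact this.ne'
  have h1 : Real.log 2.8557 - (2 * 2.8557 ^ 2 + 2.8557 - 1) / (2 * 2.8557 ^ 2 + 1) ≤ 0 := by
    have e : 2 * Real.log 2.8557 = 3 * Real.log 2 + Real.log (2.8557 ^ 2 / 8) := by
      rw [Real.log_div (by norm_num) (by norm_num), show (8 : ℝ) = 2 ^ 3 by norm_num,
        Real.log_pow, Real.log_pow]
      push_cast
      ring
    have h := Real.log_le_sub_one_of_pos (x := 2.8557 ^ 2 / 8) (by norm_num)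
    have h2 := Real.log_two_lt_d9
    norm_num at e h h2 ⊢
    linarith
  have h2 : 0 ≤ Real.log (20 / 7) - (2 * (20 / 7) ^ 2 + 20 / 7 - 1) / (2 * (20 / 7) ^ 2 + 1) := by
    have := log_twenty_div_seven_gt
    norm_num at this ⊢
    linarith
  obtain ⟨s, hs, h⟩ := intermediate_value_Icc (by norm_num) hcont ⟨h1, h2⟩
  exact ⟨s, hs.1, hs.2, sub_eq_zero.1 h⟩

/-- Strict minimality of the stationary point, with denominators cleared. The difference `ψ`
vanishes at `s₀`, and its derivative has the sign of `t - s₀` for `t > 1`. -/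
theorem mul_log_lt {s₀ s : ℝ} (h₀ : 1 < s₀) (hs : 1 < s) (hne : s ≠ s₀)
    (hlog : Real.log s₀ = (2 * s₀ ^ 2 + s₀ - 1) / (2 * s₀ ^ 2 + 1)) :
    (2 * s₀ + 1 / s₀) * Real.log s < 2 * s + 1 - 1 / s := by
  set ψ : ℝ → ℝ := fun s => 2 * s + 1 - s⁻¹ - (2 * s₀ + 1 / s₀) * Real.log s with hψ
  have hderiv : ∀ t, 0 < t → HasDerivAt ψ ((t - s₀) * (2 * t - 1 / s₀) / t ^ 2) t := by
    intro t ht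
    have := ((((hasDerivAt_id t).const_mul 2).add_const 1).sub (hasDerivAt_inv ht.ne')).sub
      ((Real.hasDerivAt_log ht.ne').const_mul (2 * s₀ + 1 / s₀))
    refine this.congr_deriv ?_
    field_simp
    ring
  have hcont : ∀ D : Set ℝ, (∀ t ∈ D, 0 < t) → ContinuousOn ψ D := fun D hD t ht =>
    (hderiv t (hD t ht)).continuousAt.continuousWithinAt
  have hzero : ψ s₀ = 0 := by
    simp only [hψ, hlog]
    field_simp
    ring
  have hfac : ∀ t, 1 < t → 0 < 2 * t - 1 / s₀ := by
    intro t ht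
    have : 1 / s₀ < 1 := (div_lt_one (by linarith)).2 h₀
    linarith
  have hpos : 0 < ψ s := by
    rw [← hzero]
    rcases lt_or_gt_of_ne hne with h | h
    · refine strictAntiOn_of_deriv_neg (convex_Icc 1 s₀) (hcont _ fun t ht => by linarith [ht.1])
        (fun t ht => ?_) ⟨hs.le, h.le⟩ ⟨h₀.le, le_rfl⟩ h
      rw [interior_Icc] at ht
      have ht0 : 0 < t := by linarith [ht.1]
      rw [(hderiv t ht0).deriv]
      exact div_neg_of_neg_of_pos (mul_neg_of_neg_of_pos (by linarith [ht.2]) (hfac t ht.1))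
        (by positivity)
    · refine strictMonoOn_of_deriv_pos (convex_Ici s₀) (hcont _ fun t ht => lt_of_lt_of_le
        (by linarith) ht) (fun t ht => ?_) (Set.self_mem_Ici) h.le h
      rw [interior_Ici] at ht
      have ht' : s₀ < t := ht
      have ht0 : 0 < t := by linarith
      rw [(hderiv t ht0).deriv]
      exact div_pos (mul_pos (by linarith) (hfac t (by linarith))) (by positivity)
  simp only [hψ, ← one_div] at hpos
  linarith

theorem ratio_sq {s : ℝ} (hs : 1 < s) :
    (√(s ^ 2) + 2 * s ^ 2 - 1) / (√(s ^ 2) * Real.log (s ^ 2)) =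
      (2 * s + 1 - 1 / s) / (2 * Real.log s) := by
  have := Real.log_pos hs
  rw [Real.sqrt_sq (by linarith), Real.log_pow]
  push_cast
  field_simp
  ring

theorem exists_unique_minimizer_ratio : ∃ b₀ : ℝ, 1 < b₀ ∧ |b₀ - 8.16| < 0.005 ∧
    (∀ b : ℝ, 1 < b → b ≠ b₀ →
      (√b₀ + 2 * b₀ - 1) / (√b₀ * Real.log b₀) < (√b + 2 * b - 1) / (√b * Real.log b)) ∧
    (√b₀ + 2 * b₀ - 1) / (√b₀ * Real.log b₀) < 3.032 := by
  obtain ⟨s₀, hl, hu, hlog⟩ := exists_log_eq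
  have h₀ : 1 < s₀ := lt_of_lt_of_le (by norm_num) hl
  have hmin : (2 * s₀ + 1 - 1 / s₀) / (2 * Real.log s₀) = (2 * s₀ + 1 / s₀) / 2 := by
    have h1 : 2 * s₀ + 1 - 1 / s₀ = (2 * s₀ + 1 / s₀) * Real.log s₀ := by
      rw [hlog]
      field_simp
    have := Real.log_pos h₀
    rw [h1]
    field_simp
  refine ⟨s₀ ^ 2, by nlinarith, ?_, fun b hb hne => ?_, ?_⟩
  · rw [abs_lt]
    norm_num at hl ⊢
    constructor <;> nlinarith
  · have hs : 1 < √b := Real.lt_sqrt_of_sq_lt (by linarith)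
    have hb2 : √b ^ 2 = b := Real.sq_sqrt (by linarith)
    have hne' : √b ≠ s₀ := by
      intro h
      rw [h] at hb2
      exact hne hb2.symm
    have hr := ratio_sq hs
    rw [hb2] at hr
    rw [hr, ratio_sq h₀, hmin, div_lt_div_iff₀ two_pos (by linarith [Real.log_pos hs])]
    linarith [mul_log_lt h₀ hs hne' hlog]
  · rw [ratio_sq h₀, hmin]
    -- Inserting `s₀ ≤ 20 / 7` here just fails, giving about `6.0643`. Instead the minimum is
    -- compared with the value of the ratio at `s = 20 / 7`.
    have hlt : 2 * s₀ + 1 / s₀ < 6.064 := by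
      rcases hu.eq_or_lt with h | h
      · exfalso
        have := log_twenty_div_seven_gt
        rw [← h, hlog, h] at this
        norm_num at this
      · have h1 := mul_log_lt h₀ (by norm_num) h.ne' hlog
        have h2 := log_twenty_div_seven_gt
        have h3 : 0 < 2 * s₀ + 1 / s₀ := by positivity
        have h4 := mul_lt_mul_of_pos_left h2 h3
        norm_num at h1 h4 ⊢
        linarith
    linarith

end Ratio

/-! ### Expectation over the random offset -/

section Expectation

open MeasureTheory

variable {n : ℕ} {b : ℝ} {σ : Equiv.Perm (Fin n)} {p w : Fin n → ℝ}

/-- The round in which job `j` is finished. -/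
def finishRound (b ξ : ℝ) (p w : Fin n → ℝ) (j : Fin n) : ℤ := ⌈Real.logb b (p j / w j) - ξ⌉

theorem le_mul_unit_iff {ξ : ℝ} (hb : 1 < b) (hp : ∀ j, 0 < p j) (hw : ∀ j, 0 < w j) (j : Fin n)
    (q : ℤ) : p j ≤ w j * unit b ξ q ↔ finishRound b ξ p w j ≤ q := by
  rw [finishRound, Int.ceil_le, sub_le_iff_le_add,
    Real.logb_le_iff_le_rpow hb (div_pos (hp j) (hw j)), div_le_iff₀' (hw j), unit]

theorem unit_finishRound {ξ : ℝ} (hb : 1 < b) (hp : ∀ j, 0 < p j) (hw : ∀ j, 0 < w j)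
    (j : Fin n) : unit b ξ (finishRound b ξ p w j) =
      p j / w j * b ^ Int.fract (ξ - Real.logb b (p j / w j)) := by
  have h : ((finishRound b ξ p w j : ℤ) : ℝ) + ξ =
      Real.logb b (p j / w j) + Int.fract (ξ - Real.logb b (p j / w j)) := by
    rw [finishRound, ← neg_sub, Int.ceil_neg, Int.fract]
    push_cast
    ring
  rw [unit, h, Real.rpow_add (by linarith),
    Real.rpow_logb (by linarith) hb.ne' (div_pos (hp j) (hw j))]

theorem unit_finishRound_le {ξ : ℝ} (hb : 1 < b) (hp : ∀ j, 0 < p j) (hw : ∀ j, 0 < w j)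
    (j : Fin n) : unit b ξ (finishRound b ξ p w j) ≤ p j / w j * b := by
  rw [unit_finishRound hb hp hw]
  refine mul_le_mul_of_nonneg_left ?_ (div_pos (hp j) (hw j)).le
  calc b ^ Int.fract (ξ - Real.logb b (p j / w j)) ≤ b ^ (1 : ℝ) :=
        Real.rpow_le_rpow_of_exponent_le hb.le (Int.fract_lt_one _).le
    _ = b := Real.rpow_one b

/-- A uniformly distributed offset is, after a shift, uniformly distributed modulo `1`. -/
theorem integral_fract_sub (G : ℝ → ℝ) (a : ℝ) :
    ∫ ξ in (0 : ℝ)..1, G (Int.fract (ξ - a)) = ∫ u in (0 : ℝ)..1, G u := by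
  have hper : Function.Periodic (fun t => G (Int.fract t)) 1 := fun t => by
    simp [Int.fract_add_one]
  have h := hper.intervalIntegral_add_eq (-a) 0
  rw [intervalIntegral.integral_comp_sub_right (fun t => G (Int.fract t)), zero_sub,
    show (1 : ℝ) - a = -a + 1 by ring, h, zero_add]
  refine intervalIntegral.integral_congr_Ioo_of_le zero_le_one fun u hu => ?_
  rw [Int.fract_eq_self.2 ⟨hu.1.le, hu.2⟩]

theorem integral_rpow_const (hb : 1 < b) (u v : ℝ) :
    ∫ t in u..v, b ^ t = (b ^ v - b ^ u) / Real.log b := by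
  have hb0 : 0 < b := by linarith
  have hL := Real.log_pos hb
  have hd : ∀ t ∈ Set.uIcc u v, HasDerivAt (fun t => b ^ t / Real.log b) (b ^ t) t := by
    intro t _
    refine ((Real.hasStrictDerivAt_const_rpow hb0 t).hasDerivAt.div_const _).congr_deriv ?_
    field_simp
  rw [intervalIntegral.integral_eq_sub_of_hasDerivAt hd
    ((Real.continuous_const_rpow hb0.ne').intervalIntegrable _ _)]
  ring

theorem integral_add_mul_rpow (hb : 1 < b) (c d u v : ℝ) :
    ∫ t in u..v, (c + d * b ^ t) = c * (v - u) + d * ((b ^ v - b ^ u) / Real.log b) := by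
  have hc : Continuous fun t : ℝ => b ^ t := Real.continuous_const_rpow (by linarith)
  rw [intervalIntegral.integral_add (by simp) ((hc.const_mul d).intervalIntegrable _ _),
    intervalIntegral.integral_const_mul, integral_rpow_const hb, intervalIntegral.integral_const,
    smul_eq_mul, mul_comm c]

/-- The integrand changes branch at `u = logb b (y / x)`, which lies inside the unit interval only
if `y ≤ b * x`; this matches the two closed forms of the kernel. -/
theorem integral_ite_eq_pairKernel (hb : 1 < b) {x y : ℝ} (hx : 0 < x) (hxy : x ≤ y) :
    ∫ u in (0 : ℝ)..1, (if y ≤ x * b ^ u then y + 2 / (b - 1) * (x * b ^ u)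
      else x + (b + 1) / (b - 1) * (x * b ^ u)) =
      2 * pairKernel b x y - x * (1 + 2 / Real.log b) := by
  have hb0 : 0 < b := by linarith
  have hb1 : 0 < b - 1 := by linarith
  have hL := Real.log_pos hb
  have hy : 0 < y := hx.trans_le hxy
  have hc : Continuous fun t : ℝ => b ^ t := Real.continuous_const_rpow (by linarith)
  set G : ℝ → ℝ := fun u => if y ≤ x * b ^ u then y + 2 / (b - 1) * (x * b ^ u)
      else x + (b + 1) / (b - 1) * (x * b ^ u) with hG
  have hiff : ∀ u : ℝ, y ≤ x * b ^ u ↔ Real.logb b (y / x) ≤ u := by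
    intro u
    rw [Real.logb_le_iff_le_rpow hb (div_pos hy hx), div_le_iff₀' hx]
  have hlow : ∀ v, 0 ≤ v → v ≤ Real.logb b (y / x) → Set.EqOn (fun u => x +
      (b + 1) / (b - 1) * x * b ^ u) G (Set.Ioo 0 v) := by
    intro v _ hvl u hu
    have h1 : ¬ y ≤ x * b ^ u := by
      rw [hiff, not_le]
      exact hu.2.trans_le hvl
    simp only [hG, if_neg h1]
    ring
  by_cases hyx : y ≤ b * x
  · set v := Real.logb b (y / x) with hv
    have hv0 : 0 ≤ v := Real.logb_nonneg hb ((one_le_div hx).2 hxy)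
    have hv1 : v ≤ 1 := by
      rw [hv, Real.logb_le_iff_le_rpow hb (div_pos hy hx), Real.rpow_one, div_le_iff₀ hx]
      exact hyx
    have hbv : b ^ v = y / x := Real.rpow_logb hb0 hb.ne' (div_pos hy hx)
    have hhigh : Set.EqOn (fun u => y + 2 / (b - 1) * x * b ^ u) G (Set.Ioo v 1) := by
      intro u hu
      simp only [hG, if_pos ((hiff u).2 hu.1.le)]
      ring
    have i1 : IntervalIntegrable G volume 0 v := by
      refine ((continuous_const.add (hc.const_mul _)).intervalIntegrable 0 v).congr_uIoo
        (f := fun u => x + (b + 1) / (b - 1) * x * b ^ u) ?_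
      rw [Set.uIoo_of_le hv0]
      exact hlow v hv0 le_rfl
    have i2 : IntervalIntegrable G volume v 1 := by
      refine ((continuous_const.add (hc.const_mul _)).intervalIntegrable v 1).congr_uIoo
        (f := fun u => y + 2 / (b - 1) * x * b ^ u) ?_
      rw [Set.uIoo_of_le hv1]
      exact hhigh
    rw [← intervalIntegral.integral_add_adjacent_intervals i1 i2,
      ← intervalIntegral.integral_congr_Ioo_of_le hv0 (hlow v hv0 le_rfl),
      ← intervalIntegral.integral_congr_Ioo_of_le hv1 hhigh,
      integral_add_mul_rpow hb, integral_add_mul_rpow hb, hbv, Real.rpow_zero, Real.rpow_one,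
      pairKernel_eq_of_le_mul hb hx hxy hyx]
    have hvlog : Real.log (y / x) = v * Real.log b := by
      rw [hv, Real.logb, div_mul_cancel₀ _ hL.ne']
    rw [hvlog]
    field_simp
    ring
  · have hv1 : 1 ≤ Real.logb b (y / x) := by
      rw [Real.le_logb_iff_rpow_le hb (div_pos hy hx), Real.rpow_one, le_div_iff₀ hx]
      exact (not_le.1 hyx).le
    rw [← intervalIntegral.integral_congr_Ioo_of_le zero_le_one (hlow 1 zero_le_one hv1),
      integral_add_mul_rpow hb, Real.rpow_zero, Real.rpow_one,
      pairKernel_eq_of_mul_le hb hx (not_le.1 hyx).le]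
    field_simp
    ring

theorem integral_timeSpent_self (hb : 1 < b) (hp : ∀ j, 0 < p j) (hw : ∀ j, 0 < w j)
    (j : Fin n) : ∫ ξ in (0 : ℝ)..1, timeSpent b ξ σ p w (finishRound b ξ p w) j j =
      p j * (1 + 1 / Real.log b) := by
  have hb1 : b - 1 ≠ 0 := by linarith
  have hL := Real.log_pos hb
  have h : ∀ ξ, timeSpent b ξ σ p w (finishRound b ξ p w) j j =
      (fun u => p j + p j / (b - 1) * b ^ u) (Int.fract (ξ - Real.logb b (p j / w j))) := by
    intro ξ
    rw [timeSpent, if_pos le_rfl, timeFinished, unit_finishRound hb hp hw]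
    have := (hw j).ne'
    field_simp
  simp_rw [h]
  rw [integral_fract_sub (fun u => p j + p j / (b - 1) * b ^ u), integral_add_mul_rpow hb,
    Real.rpow_zero, Real.rpow_one]
  field_simp
  ring

/-- If the job of smaller ratio comes first in the order, it always finishes first. Otherwise `k`
overtakes it exactly when both finish in the same round; if not, `k` has already been probed once
more, in the round in which `j` finishes. -/
theorem integral_timeSpent_add (hb : 1 < b) (hp : ∀ j, 0 < p j) (hw : ∀ j, 0 < w j)
    {j k : Fin n} (hjk : j ≠ k) (hle : p j / w j ≤ p k / w k) :
    ∫ ξ in (0 : ℝ)..1, (w j * timeSpent b ξ σ p w (finishRound b ξ p w) j k +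
      w k * timeSpent b ξ σ p w (finishRound b ξ p w) k j) =
      if σ j < σ k then w j * w k * (p j / w j * (1 + 2 / Real.log b)) else
        w j * w k * (2 * pairKernel b (p j / w j) (p k / w k) -
          p j / w j * (1 + 2 / Real.log b)) := by
  have hb1 : b - 1 ≠ 0 := by linarith
  have hL := Real.log_pos hb
  have hx : 0 < p j / w j := div_pos (hp j) (hw j)
  have hpj : p j = w j * (p j / w j) := by have := (hw j).ne'; field_simp
  have hpk : p k = w k * (p k / w k) := by have := (hw k).ne'; field_simp
  have hunit := fun ξ => unit_finishRound (ξ := ξ) hb hp hw j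
  have hf := fun ξ => le_mul_unit_iff (ξ := ξ) hb hp hw
  have hfle : ∀ ξ, finishRound b ξ p w j ≤ finishRound b ξ p w k := by
    intro ξ
    rw [← hf ξ, ← div_le_iff₀' (hw j)]
    exact hle.trans ((div_le_iff₀' (hw k)).2 ((hf ξ k _).2 le_rfl))
  have hkj : ∀ ξ, p k / w k ≤ unit b ξ (finishRound b ξ p w j) ↔
      finishRound b ξ p w k ≤ finishRound b ξ p w j := by
    intro ξ
    rw [← hf ξ, ← div_le_iff₀' (hw k)]
  set x := p j / w j with hxdef
  set y := p k / w k with hydef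
  split_ifs with hσ
  · have h : ∀ ξ, w j * timeSpent b ξ σ p w (finishRound b ξ p w) j k +
        w k * timeSpent b ξ σ p w (finishRound b ξ p w) k j =
        (fun u => w j * w k * x + w j * w k * (2 / (b - 1) * x) * b ^ u)
          (Int.fract (ξ - Real.logb b x)) := by
      intro ξ
      have h1 : slot σ (finishRound b ξ p w j) j < slot σ (finishRound b ξ p w k) k := by
        rw [slot_lt]
        have := hfle ξ
        simp only [hσ, and_true]
        omega
      rw [timeSpent, timeSpent, if_neg h1.not_ge, if_pos h1.le, timeFinished, nextRound,
        if_neg hσ.not_gt, hunit, hpj]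
      ring
    simp_rw [h]
    rw [integral_fract_sub (fun u => w j * w k * x + w j * w k * (2 / (b - 1) * x) * b ^ u),
      integral_add_mul_rpow hb, Real.rpow_zero, Real.rpow_one]
    field_simp
    ring
  · have hσ' : σ k < σ j := lt_of_le_of_ne (not_lt.1 hσ) (σ.injective.ne hjk.symm)
    have h : ∀ ξ, w j * timeSpent b ξ σ p w (finishRound b ξ p w) j k +
        w k * timeSpent b ξ σ p w (finishRound b ξ p w) k j =
        w j * w k * (fun u => if y ≤ x * b ^ u then y + 2 / (b - 1) * (x * b ^ u)
          else x + (b + 1) / (b - 1) * (x * b ^ u)) (Int.fract (ξ - Real.logb b x)) := by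
      intro ξ
      dsimp only
      rw [← hunit]
      by_cases hy : y ≤ unit b ξ (finishRound b ξ p w j)
      · have he : finishRound b ξ p w k = finishRound b ξ p w j :=
          le_antisymm ((hkj ξ).1 hy) (hfle ξ)
        have h1 : slot σ (finishRound b ξ p w k) k < slot σ (finishRound b ξ p w j) j := by
          rw [slot_lt]
          exact Or.inr ⟨he, hσ'⟩
        rw [if_pos hy, timeSpent, timeSpent, if_neg h1.not_ge, if_pos h1.le, timeFinished,
          nextRound, if_neg hσ, he, hpk]
        ring
      · have hlt := lt_of_not_ge (mt (hkj ξ).2 hy)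
        have h1 : slot σ (finishRound b ξ p w j) j < slot σ (finishRound b ξ p w k) k := by
          rw [slot_lt]
          exact Or.inl hlt
        rw [if_neg hy, timeSpent, timeSpent, if_neg h1.not_ge, if_pos h1.le, timeFinished,
          nextRound, if_pos hσ', unit_add_one hb, hpj]
        ring
    simp_rw [h]
    rw [intervalIntegral.integral_const_mul, integral_fract_sub (fun u =>
      if y ≤ x * b ^ u then y + 2 / (b - 1) * (x * b ^ u)
      else x + (b + 1) / (b - 1) * (x * b ^ u)), integral_ite_eq_pairKernel hb hx hle]

/-! ### Averaging over the random order -/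

theorem sum_perm_ite_lt {j k : Fin n} (hjk : j ≠ k) (u v : ℝ) :
    ∑ σ : Equiv.Perm (Fin n), (if σ j < σ k then u else v) = (n.factorial : ℝ) * ((u + v) / 2) := by
  have h1 : ∑ σ : Equiv.Perm (Fin n), (if σ j < σ k then u else v) =
      ∑ σ : Equiv.Perm (Fin n), (if σ k < σ j then u else v) := by
    rw [← Equiv.sum_comp (Equiv.mulRight (Equiv.swap j k))]
    simp
  have h2 : ∑ σ : Equiv.Perm (Fin n), (if σ j < σ k then u else v) +
      ∑ σ : Equiv.Perm (Fin n), (if σ k < σ j then u else v) = (n.factorial : ℝ) * (u + v) := by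
    rw [← Finset.sum_add_distrib]
    have : ∀ σ : Equiv.Perm (Fin n),
        (if σ j < σ k then u else v) + (if σ k < σ j then u else v) = u + v := by
      intro σ
      rcases lt_or_gt_of_ne (σ.injective.ne hjk) with h | h
      · rw [if_pos h, if_neg h.not_gt]
      · rw [if_neg h.not_gt, if_pos h, add_comm]
    simp only [this, Finset.sum_const, Finset.card_univ, Fintype.card_perm, Fintype.card_fin,
      nsmul_eq_mul]
  linarith

/-- The terms `x * (1 + 2 / log b)` of the two relative orders cancel. On the diagonal the
symmetrized sum counts a job's own time twice, and the kernel falls short of this by `w j * p j`. -/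
theorem sum_perm_integral_timeSpent_add (hb : 1 < b) (hp : ∀ j, 0 < p j) (hw : ∀ j, 0 < w j)
    (j k : Fin n) :
    ∑ σ : Equiv.Perm (Fin n), ∫ ξ in (0 : ℝ)..1,
      (w j * timeSpent b ξ σ p w (finishRound b ξ p w) j k +
        w k * timeSpent b ξ σ p w (finishRound b ξ p w) k j) =
      (n.factorial : ℝ) * (w j * w k * pairKernel b (p j / w j) (p k / w k) +
        if j = k then w j * p j else 0) := by
  have hL := Real.log_pos hb
  have hlt : ∀ j k : Fin n, j ≠ k → p j / w j ≤ p k / w k →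
      ∑ σ : Equiv.Perm (Fin n), ∫ ξ in (0 : ℝ)..1,
      (w j * timeSpent b ξ σ p w (finishRound b ξ p w) j k +
        w k * timeSpent b ξ σ p w (finishRound b ξ p w) k j) =
      (n.factorial : ℝ) * (w j * w k * pairKernel b (p j / w j) (p k / w k)) := by
    intro j k hjk hle
    simp_rw [integral_timeSpent_add hb hp hw hjk hle]
    rw [sum_perm_ite_lt hjk]
    ring
  by_cases hjk : j = k
  · subst hjk
    have h : ∀ σ : Equiv.Perm (Fin n), ∫ ξ in (0 : ℝ)..1,
        (w j * timeSpent b ξ σ p w (finishRound b ξ p w) j j +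
        w j * timeSpent b ξ σ p w (finishRound b ξ p w) j j) =
        2 * w j * (p j * (1 + 1 / Real.log b)) := by
      intro σ
      simp_rw [← two_mul, ← mul_assoc]
      rw [intervalIntegral.integral_const_mul, integral_timeSpent_self hb hp hw]
      ring
    have hx : 0 < p j / w j := div_pos (hp j) (hw j)
    simp_rw [h]
    rw [if_pos trivial, pairKernel_eq_of_le_mul hb hx le_rfl (by nlinarith), Finset.sum_const,
      Finset.card_univ, Fintype.card_perm, Fintype.card_fin, nsmul_eq_mul]
    have := (hw j).ne'
    field_simp
    ring
  · rw [if_neg hjk, add_zero]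
    rcases le_total (p j / w j) (p k / w k) with hle | hle
    · exact hlt j k hjk hle
    · have := hlt k j (Ne.symm hjk) hle
      rw [pairKernel_comm hb, mul_comm (w j), ← this]
      simp_rw [add_comm]

theorem measurable_timeSpent (j l : Fin n) :
    Measurable fun ξ => timeSpent b ξ σ p w (finishRound b ξ p w) j l := by
  have hf : ∀ j, Measurable fun ξ => finishRound b ξ p w j := fun j =>
    (measurable_const.sub measurable_id).ceil
  have hunit : ∀ g : ℝ → ℤ, Measurable g → Measurable fun ξ => unit b ξ (g ξ) := fun g hg =>
    measurable_const.pow ((measurable_from_top.comp hg).add measurable_id)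
  have hset : MeasurableSet {ξ | slot σ (finishRound b ξ p w l) l ≤
      slot σ (finishRound b ξ p w j) j} := by
    simp_rw [slot_le]
    exact (measurableSet_lt (hf l) (hf j)).union
      ((measurableSet_eq_fun (hf l) (hf j)).inter (MeasurableSet.const _))
  refine Measurable.ite hset ?_ ?_
  · exact measurable_const.add (((hunit _ (hf l)).div_const _).const_mul _)
  · refine ((hunit _ ?_).div_const _).const_mul _
    unfold nextRound
    exact Measurable.ite (MeasurableSet.const _) ((hf j).add_const 1) (hf j)

theorem integrable_timeSpent (hb : 1 < b) (hp : ∀ j, 0 < p j) (hw : ∀ j, 0 < w j)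
    (j l : Fin n) :
    Integrable (fun ξ => timeSpent b ξ σ p w (finishRound b ξ p w) j l) uniformOffset := by
  have hb1 : 0 < b - 1 := by linarith
  refine Integrable.of_bound (measurable_timeSpent j l).aestronglyMeasurable
    (p l + w l * (p l / w l * b / (b - 1)) + w l * (b * (p j / w j * b) / (b - 1)))
    (Filter.Eventually.of_forall fun ξ => ?_)
  rw [Real.norm_of_nonneg (timeSpent_pos hb hp hw j l).le]
  have h1 : timeFinished b ξ p w (finishRound b ξ p w) l ≤
      p l + w l * (p l / w l * b / (b - 1)) := by
    have := unit_finishRound_le (ξ := ξ) hb hp hw l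
    have := (hw l).le
    unfold timeFinished
    gcongr
  have h2 : w l * (unit b ξ (nextRound σ (finishRound b ξ p w j) j l) / (b - 1)) ≤
      w l * (b * (p j / w j * b) / (b - 1)) := by
    have h3 : unit b ξ (nextRound σ (finishRound b ξ p w j) j l) ≤ b * (p j / w j * b) := by
      refine (unit_mono hb (r := finishRound b ξ p w j + 1) ?_).trans ?_
      · unfold nextRound
        split_ifs <;> omega
      · rw [unit_add_one hb]
        exact mul_le_mul_of_nonneg_left (unit_finishRound_le hb hp hw j) (by linarith)
    have := (hw l).le
    gcongr
  have h3 := timeFinished_pos (ξ := ξ) (f := finishRound b ξ p w) hb hp hw l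
  have h4 := mul_pos (hw l)
    (div_pos (unit_pos (ξ := ξ) hb (nextRound σ (finishRound b ξ p w j) j l)) hb1)
  unfold timeSpent
  split_ifs <;> linarith

theorem integral_uniformOffset (g : ℝ → ℝ) :
    ∫ ξ, g ξ ∂uniformOffset = ∫ ξ in (0 : ℝ)..1, g ξ := by
  rw [uniformOffset, integral_Icc_eq_integral_Ioc, intervalIntegral.integral_of_le zero_le_one]

theorem measurable_cost (hb : 1 < b) (hp : ∀ j, 0 < p j) (hw : ∀ j, 0 < w j) :
    Measurable fun ω : Equiv.Perm (Fin n) × ℝ => cost (bScaling b hb ω.1 ω.2 w hw) p w := by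
  simp_rw [fun ω : Equiv.Perm (Fin n) × ℝ => cost_bScaling (σ := ω.1) hb hp hw
    (le_mul_unit_iff (ξ := ω.2) hb hp hw)]
  refine measurable_from_prod_countable_right fun σ => ENNReal.measurable_ofReal.comp ?_
  exact Finset.measurable_fun_sum _ fun j _ => Finset.measurable_fun_sum _ fun k _ =>
    (measurable_timeSpent j k).const_mul _

/-- The expected cost of the randomized strategy. -/
theorem lintegral_cost (hb : 1 < b) (hp : ∀ j, 0 < p j) (hw : ∀ j, 0 < w j) :
    ∫⁻ ω, cost (bScaling b hb ω.1 ω.2 w hw) p w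
      ∂((PMF.uniformOfFintype (Equiv.Perm (Fin n))).toMeasure.prod uniformOffset) =
    ENNReal.ofReal (2⁻¹ * (∑ j, ∑ k, w j * w k * pairKernel b (p j / w j) (p k / w k) +
      ∑ j, w j * p j)) := by
  have hcost := fun (σ : Equiv.Perm (Fin n)) (ξ : ℝ) => cost_bScaling (σ := σ) hb hp hw
    (le_mul_unit_iff (ξ := ξ) hb hp hw)
  have hint : ∀ (σ : Equiv.Perm (Fin n)) (j k : Fin n), Integrable
      (fun ξ => w j * timeSpent b ξ σ p w (finishRound b ξ p w) j k) uniformOffset :=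
    fun σ j k => (integrable_timeSpent hb hp hw j k).const_mul _
  have hnn : ∀ (σ : Equiv.Perm (Fin n)) (ξ : ℝ),
      0 ≤ ∑ j, ∑ k, w j * timeSpent b ξ σ p w (finishRound b ξ p w) j k := fun σ ξ =>
    Finset.sum_nonneg fun j _ => Finset.sum_nonneg fun k _ =>
      (mul_pos (hw j) (timeSpent_pos hb hp hw j k)).le
  -- The double sum is symmetrized, because only the mutual delay of a pair has a simple
  -- expectation.
  have hexp : ∀ σ : Equiv.Perm (Fin n),
      ∫ ξ, ∑ j, ∑ k, w j * timeSpent b ξ σ p w (finishRound b ξ p w) j k ∂uniformOffset =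
      2⁻¹ * ∑ j, ∑ k, ∫ ξ in (0 : ℝ)..1,
        (w j * timeSpent b ξ σ p w (finishRound b ξ p w) j k +
          w k * timeSpent b ξ σ p w (finishRound b ξ p w) k j) := by
    intro σ
    rw [integral_finsetSum _ fun j _ => integrable_finsetSum _ fun k _ => hint σ j k]
    simp_rw [fun j => integral_finsetSum Finset.univ fun k _ => hint σ j k,
      ← integral_uniformOffset, fun j k => integral_add (hint σ j k) (hint σ k j),
      Finset.sum_add_distrib]
    rw [Finset.sum_comm (f := fun j k =>
      ∫ ξ, w k * timeSpent b ξ σ p w (finishRound b ξ p w) k j ∂uniformOffset)]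
    ring
  have hfac : (0 : ℝ) < n.factorial := by exact_mod_cast n.factorial_pos
  have hmass : ∀ σ : Equiv.Perm (Fin n),
      (PMF.uniformOfFintype (Equiv.Perm (Fin n))).toMeasure {σ} =
        ENNReal.ofReal (n.factorial : ℝ)⁻¹ := by
    intro σ
    rw [PMF.toMeasure_apply_singleton _ _ (measurableSet_singleton σ), PMF.uniformOfFintype_apply, Fintype.card_perm,
      Fintype.card_fin, ENNReal.ofReal_inv_of_pos hfac, ENNReal.ofReal_natCast]
  rw [lintegral_prod _ (measurable_cost hb hp hw).aemeasurable, lintegral_fintype]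
  simp_rw [hcost, hmass]
  have hinner : ∀ σ : Equiv.Perm (Fin n), ∫⁻ ξ, ENNReal.ofReal
      (∑ j, ∑ k, w j * timeSpent b ξ σ p w (finishRound b ξ p w) j k) ∂uniformOffset =
      ENNReal.ofReal (∫ ξ, ∑ j, ∑ k, w j * timeSpent b ξ σ p w (finishRound b ξ p w) j k
        ∂uniformOffset) := fun σ => (ofReal_integral_eq_lintegral_ofReal
          (integrable_finsetSum _ fun j _ => integrable_finsetSum _ fun k _ => hint σ j k)
          (Filter.Eventually.of_forall (hnn σ))).symm
  have hInn : ∀ σ : Equiv.Perm (Fin n), 0 ≤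
      ∫ ξ, ∑ j, ∑ k, w j * timeSpent b ξ σ p w (finishRound b ξ p w) j k ∂uniformOffset :=
    fun σ => integral_nonneg (hnn σ)
  simp_rw [hinner, ← ENNReal.ofReal_mul (hInn _)]
  rw [← ENNReal.ofReal_sum_of_nonneg fun σ _ => mul_nonneg (hInn σ) (inv_pos.2 hfac).le]
  congr 1
  simp_rw [hexp]
  rw [← Finset.sum_mul, ← Finset.mul_sum, Finset.sum_comm]
  simp_rw [Finset.sum_comm (s := Finset.univ (α := Equiv.Perm (Fin n))),
    sum_perm_integral_timeSpent_add hb hp hw, ← Finset.mul_sum, Finset.sum_add_distrib]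
  simp only [Finset.sum_ite_eq, Finset.mem_univ, if_true]
  field_simp

/-! ### Comparison with the optimum -/

/-- Whichever of two jobs comes later in the sequence waits for the other, so each pair pays at
least `min (w k * p j) (w j * p k)`. -/
theorem le_sequenceCost (hw : ∀ j, 0 < w j) (π : Equiv.Perm (Fin n)) :
    2⁻¹ * (∑ j, ∑ k, w j * w k * min (p j / w j) (p k / w k) + ∑ j, w j * p j) ≤
      sequenceCost p w π := by
  have h1 : sequenceCost p w π = ∑ j, ∑ k, if π k ≤ π j then w j * p k else 0 := by
    unfold sequenceCost
    refine Finset.sum_congr rfl fun j _ => ?_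
    rw [Finset.sum_filter, Finset.mul_sum]
    refine Finset.sum_congr rfl fun k _ => ?_
    split_ifs <;> simp
  have h2 : ∑ j, w j * p j = ∑ j, ∑ k, if j = k then w j * p j else 0 := by simp
  have h3 : 2 * sequenceCost p w π = ∑ j, ∑ k,
      ((if π k ≤ π j then w j * p k else 0) + if π j ≤ π k then w k * p j else 0) := by
    simp_rw [Finset.sum_add_distrib]
    rw [Finset.sum_comm (f := fun j k => if π j ≤ π k then w k * p j else 0), two_mul, h1]
  have h4 : ∑ j, ∑ k, w j * w k * min (p j / w j) (p k / w k) + ∑ j, w j * p j ≤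
      2 * sequenceCost p w π := by
    rw [h3, h2, ← Finset.sum_add_distrib]
    refine Finset.sum_le_sum fun j _ => ?_
    rw [← Finset.sum_add_distrib]
    refine Finset.sum_le_sum fun k _ => ?_
    have hj := hw j
    have hk := hw k
    have e1 : w j * w k * (p j / w j) = w k * p j := by field_simp
    have e2 : w j * w k * (p k / w k) = w j * p k := by field_simp
    rw [mul_min_of_nonneg _ _ (mul_pos hj hk).le, e1, e2]
    by_cases hjk : j = k
    · subst hjk
      simp
    · rw [if_neg hjk, add_zero]
      rcases lt_or_gt_of_ne (π.injective.ne hjk) with h | h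
      · rw [if_neg h.not_ge, if_pos h.le, zero_add]
        exact min_le_left _ _
      · rw [if_pos h.le, if_neg h.not_ge, add_zero]
        exact min_le_right _ _
  linarith

/-- Needed for the summand `∑ j, w j * p j`, which occurs with the same coefficient in the expected
cost and in the lower bound on the optimum. -/
theorem one_le_ratio (hb : 1 < b) : 1 ≤ (√b + 2 * b - 1) / (√b * Real.log b) := by
  have hs : 1 < √b := Real.lt_sqrt_of_sq_lt (by linarith)
  have hb2 : √b ^ 2 = b := Real.sq_sqrt (by linarith)
  have hlog : Real.log b = 2 * Real.log √b := by
    rw [Real.log_sqrt (by linarith)]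
    ring
  have h := Real.log_le_sub_one_of_pos (x := √b) (by linarith)
  rw [one_le_div (mul_pos (by linarith) (Real.log_pos hb)), hlog]
  nlinarith

theorem isCompetitive_randomizedBScaling (hb : 1 < b) :
    IsCompetitive (randomizedBScaling b hb) ((√b + 2 * b - 1) / (√b * Real.log b)) := by
  intro n p w hp hw
  refine ⟨(measurable_cost hb hp hw).aemeasurable, (lintegral_cost hb hp hw).trans_le ?_⟩
  refine ENNReal.ofReal_le_ofReal ?_
  have h1 := sum_mul_pairKernel_le hb w (fun j => p j / w j)
    fun j => (div_pos (hp j) (hw j)).le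
  have h2 := one_le_ratio hb
  have h3 : 0 ≤ ∑ j, w j * p j := Finset.sum_nonneg fun j _ => (mul_pos (hw j) (hp j)).le
  have h4 : 2⁻¹ * (∑ j, ∑ k, w j * w k * min (p j / w j) (p k / w k) + ∑ j, w j * p j) ≤
      opt p w := Finset.le_inf' _ _ fun π _ => le_sequenceCost hw π
  have h5 := mul_le_mul_of_nonneg_left h4 (zero_le_one.trans h2)
  have h6 := mul_le_mul_of_nonneg_right h2 h3
  linarith

end Expectation

end KillRestart

end

theorem mainTheorem4 :
    (∀ (b : ℝ) (hb : 1 < b), KillRestart.IsCompetitive (KillRestart.randomizedBScaling b hb)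
        ((√b + 2 * b - 1) / (√b * Real.log b))) ∧
      ∃ b₀ : ℝ, 1 < b₀ ∧ |b₀ - 8.16| < 0.005 ∧
        (∀ b : ℝ, 1 < b → b ≠ b₀ →
          (√b₀ + 2 * b₀ - 1) / (√b₀ * Real.log b₀) < (√b + 2 * b - 1) / (√b * Real.log b)) ∧
        (√b₀ + 2 * b₀ - 1) / (√b₀ * Real.log b₀) < 3.032 :=
  ⟨fun _ hb => KillRestart.isCompetitive_randomizedBScaling hb,
    KillRestart.exists_unique_minimizer_ratio⟩
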